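/- Let $\mathbb{D}$ be the open unit disc in $\mathbb{C}$, $\overline{\mathbb{D}}$ its closure and $\mathbb{T}=\partial\mathbb{D}$. Let $\alpha\ge 0$, $g\in C(\overline{\mathbb{D}})$ and $f^{*}\in C(\mathbb{T})$, all functions being complex-valued. Suppose that $f\in C^{2}(\mathbb{D})$ solves the Dirichlet problem $$\partial_z\big[(1-|z|^{2})^{-\alpha}\,\partial_{\bar z}f\big]=g\ \text{ in }\mathbb{D},\qquad f=f^{*}\ \text{ on }\mathbb{T},$$ where $\partial_z=\frac12(\partial_x-i\partial_y)$, $\partial_{\bar z}=\frac12(\partial_x+i\partial_y)$, and the boundary condition is understood in the sense of distributions on $\mathbb{T}$: for every $\varphi\in C^{\infty}(\mathbb{T})$, $$\lim_{r\to1^-}\int_0^{2\pi}f(re^{i\theta})\varphi(e^{i\theta})\,d\theta=\int_0^{2\pi}f^{*}(e^{i\theta})\varphi(e^{i\theta})\,d\theta .$$ Let $D_f(z)$ be the (real) Jacobian matrix of $f$ at $z$, $\|D_f(z)\|=\sup\{|D_f(z)\varsigma|:|\varsigma|=1\}$, $\|f^{*}\|_\infty=\sup_{z\in\mathbb{T}}|f^{*}(z)|$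 and $\|g\|_\infty=\sup_{z\in\mathbb{D}}|g(z)|$. Then for all $z\in\mathbb{D}$, $$\|D_f(z)\|\le(\alpha+1)2^{\alpha+1}\|f^{*}\|_\infty\frac{1}{1-|z|^{2}}+\Big(\alpha+\frac43\Big)2^{\alpha+1}\|g\|_\infty .$$ In particular, if in addition $g\equiv0$ and $f$ maps $\mathbb{D}$ into $\mathbb{D}$, then for all $z\in\mathbb{D}$, $$\|D_f(z)\|\le(\alpha+1)2^{\alpha+1}\frac{1}{1-|z|^{2}} .$$ -/

import Mathlib

open scoped ContDiff

namespace AlphaHarmonic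

noncomputable section

/-- The open unit disc `𝔻` in the complex plane. -/
def disc : Set ℂ := Metric.ball 0 1

/-- The closed unit disc. -/
def closedDisc : Set ℂ := Metric.closedBall 0 1

/-- The unit circle `𝕋`. -/
def unitCircle : Set ℂ := Metric.sphere 0 1

/-- The Wirtinger derivative `∂f/∂z = (f_x - i f_y) / 2`, where `f_x` and `f_y` are the values of the
real differential of `f` on `1` and `i`. -/
def dz (f : ℂ → ℂ) (z : ℂ) : ℂ :=
  (1 / 2) * (fderiv ℝ f z 1 - Complex.I * fderiv ℝ f z Complex.I)

/-- The Wirtinger derivative `∂f/∂z̄ = (f_x + i f_y) / 2`. -/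
def dzbar (f : ℂ → ℂ) (z : ℂ) : ℂ :=
  (1 / 2) * (fderiv ℝ f z 1 + Complex.I * fderiv ℝ f z Complex.I)

/-- The weighted Laplace operator `Δ_α f = ∂_z [(1 - |z|²)^(-α) ∂_z̄ f]`. -/
def weightedLaplacian (α : ℝ) (f : ℂ → ℂ) (z : ℂ) : ℂ :=
  dz (fun w => (((1 - ‖w‖ ^ 2) ^ (-α) : ℝ) : ℂ) * dzbar f w) z

/-- The circular means `f_r (e^{iθ}) = f (r e^{iθ})` converge to `fstar` as `r → 1⁻` in the sense of
distributions on the unit circle. Smooth test functions on the circle are the smooth `2π`-periodic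
functions of the angle, and a continuous function `u` on the circle acts by `φ ↦ ∫ u φ dθ`. -/
def HasDistributionalBoundaryValue (f fstar : ℂ → ℂ) : Prop :=
  ∀ φ : ℝ → ℂ, ContDiff ℝ ∞ φ → Function.Periodic φ (2 * Real.pi) →
    Filter.Tendsto
      (fun r : ℝ => ∫ θ in (0 : ℝ)..(2 * Real.pi),
        f ((r : ℂ) * Complex.exp ((θ : ℂ) * Complex.I)) * φ θ)
      (nhdsWithin 1 (Set.Iio 1))
      (nhds (∫ θ in (0 : ℝ)..(2 * Real.pi), fstar (Complex.exp ((θ : ℂ) * Complex.I)) * φ θ))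

/-- `f` solves the Dirichlet problem `Δ_α f = g` in `𝔻`, `f = fstar` on `𝕋`, the boundary values being
taken in the sense of distributions. -/
structure SolvesDirichlet (α : ℝ) (g fstar f : ℂ → ℂ) : Prop where
  equation : ∀ z ∈ disc, weightedLaplacian α f z = g z
  boundary : HasDistributionalBoundaryValue f fstar

/-- The supremum `sup {|u z| : z ∈ S}`. -/
def supNorm (S : Set ℂ) (u : ℂ → ℂ) : ℝ :=
  sSup ((fun z => ‖u z‖) '' S)

end

end AlphaHarmonic

/-! Write the equation as a first-order system: `∂f/∂z̄ = (1 - |z|²)^α F` and `∂F/∂z = g`. The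
estimate at a point `a` is an estimate at the origin, because the system is invariant under disc
automorphisms with a weight. If `f` solves it, so does `v(z) = (1 + ā z)^α f((z + a)/(1 + ā z))`,
with a new right-hand side (`WeightedSystem.comp_mobius`). The derivatives of `f` at `a` are
recovered from `v` by `(1 - |a|²) ∂f/∂z(a) = ∂v/∂z(0) - α ā v(0)` and `(1 - |a|²) ∂f/∂z̄(a) =
∂v/∂z̄(0)`. On the closed disc `|1 + ā z| ≤ 2`, which is the origin of the factor `2^α`.

At the origin both quantities are Fourier coefficients. The modes of `f` and `F` along circles
satisfy radial differential equations, and suitable combinations (`radialDz`, `radialDzbar`) have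
derivatives containing only modes of `g`. As `s → 0` they tend to multiples of the wanted
quantities; at `s = R` their kernels vanish and only values of `v` on the circle of radius `R`
remain. As `R → 1` the circle terms contribute `(α + 1) 2^α` times the boundary bound for each
derivative. The source terms are integrated explicitly, with circle means of `|1 + b e^{it}|⁻²` and
`|1 + b e^{it}|⁻⁴` (`norm_integral_source_le`). Adding the two Wirtinger derivatives gives the
operator norm.

Distributional boundary values do not directly bound `f` near the circle. Averaging over rotations
against a trigonometric polynomial preserves the system and leaves finitely many modes, each
converging at the boundary uniformly in the angle. Nonnegative kernels of mass one therefore give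
averages bounded near the circle by any `B > ‖f*‖_∞` (`norm_avg_peakKernel_le_near_boundary`). The
estimate holds for these averages, and concentrating the kernels returns it for `f`. -/

open scoped ContDiff Topology ComplexConjugate
open Filter Set

namespace AlphaHarmonic

noncomputable section

/-! ### Wirtinger calculus -/

/-- The real-linear map `h ↦ p h + q h̄`. -/
def wirtingerCLM (p q : ℂ) : ℂ →L[ℝ] ℂ :=
  p • ContinuousLinearMap.id ℝ ℂ + q • (Complex.conjCLE : ℂ →L[ℝ] ℂ)

@[simp] theorem wirtingerCLM_apply (p q h : ℂ) : wirtingerCLM p q h = p * h + q * conj h := by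
  simp [wirtingerCLM]

theorem norm_wirtingerCLM_le (p q : ℂ) : ‖wirtingerCLM p q‖ ≤ ‖p‖ + ‖q‖ := by
  refine ContinuousLinearMap.opNorm_le_bound _ (by positivity) fun h => ?_
  rw [wirtingerCLM_apply]
  refine (norm_add_le _ _).trans ?_
  simp [add_mul]

theorem continuous_wirtingerCLM : Continuous fun x : ℂ × ℂ => wirtingerCLM x.1 x.2 := by
  unfold wirtingerCLM
  fun_prop

theorem eq_wirtingerCLM (L : ℂ →L[ℝ] ℂ) :
    L = wirtingerCLM ((1 / 2) * (L 1 - Complex.I * L Complex.I))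
      ((1 / 2) * (L 1 + Complex.I * L Complex.I)) := by
  ext h
  have : L h = h.re * L 1 + h.im * L Complex.I := by
    conv_lhs => rw [show h = h.re • (1 : ℂ) + h.im • Complex.I by simp [Complex.re_add_im]]
    rw [map_add, map_smul, map_smul]
    simp
  rw [this, wirtingerCLM_apply]
  conv_rhs => rw [show conj h = h.re - h.im * Complex.I by
    simp [Complex.ext_iff]]
  have hh : h = h.re + h.im * Complex.I := (Complex.re_add_im h).symm
  conv_rhs => enter [1, 2]; rw [hh]
  linear_combination (h.im * L Complex.I : ℂ) * Complex.I_sq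

/-- `u` is real differentiable at `z` with Wirtinger derivatives `p = ∂u/∂z` and `q = ∂u/∂z̄`. -/
def HasWirtingerDerivAt (u : ℂ → ℂ) (p q z : ℂ) : Prop :=
  HasFDerivAt u (wirtingerCLM p q) z

namespace HasWirtingerDerivAt

variable {u v : ℂ → ℂ} {p q p' q' z : ℂ}

theorem dz_eq (h : HasWirtingerDerivAt u p q z) : dz u z = p := by
  rw [dz, HasFDerivAt.fderiv h]
  simp
  linear_combination (-(p / 2) + q / 2) * Complex.I_sq

theorem dzbar_eq (h : HasWirtingerDerivAt u p q z) : dzbar u z = q := by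
  rw [dzbar, HasFDerivAt.fderiv h]
  simp
  linear_combination (p / 2 - q / 2) * Complex.I_sq

theorem continuousAt (h : HasWirtingerDerivAt u p q z) : ContinuousAt u z :=
  HasFDerivAt.continuousAt h

theorem mul (hu : HasWirtingerDerivAt u p q z) (hv : HasWirtingerDerivAt v p' q' z) :
    HasWirtingerDerivAt (fun w => u w * v w) (p * v z + u z * p') (q * v z + u z * q') z := by
  refine (HasFDerivAt.mul hu hv).congr_fderiv ?_
  ext h
  simp
  ring

theorem const_mul (c : ℂ) (hu : HasWirtingerDerivAt u p q z) :
    HasWirtingerDerivAt (fun w => c * u w) (c * p) (c * q) z := by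
  refine (HasFDerivAt.const_mul hu c).congr_fderiv ?_
  ext h
  simp
  ring

theorem comp_hasDerivAt {φ : ℂ → ℂ} {φ' : ℂ} (hu : HasWirtingerDerivAt u p q (φ z))
    (hφ : HasDerivAt φ φ' z) :
    HasWirtingerDerivAt (fun w => u (φ w)) (p * φ') (q * conj φ') z := by
  have := HasFDerivAt.comp z (f := φ) hu (hφ.hasFDerivAt.restrictScalars ℝ)
  refine this.congr_fderiv ?_
  ext h
  simp
  ring

theorem congr_deriv (hu : HasWirtingerDerivAt u p q z) (hp : p = p') (hq : q = q') :
    HasWirtingerDerivAt u p' q' z := hp ▸ hq ▸ hu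

/-- The derivative along a differentiable curve. -/
theorem hasDerivAt_comp {γ : ℝ → ℂ} {γ' : ℂ} {t : ℝ} (hu : HasWirtingerDerivAt u p q (γ t))
    (hγ : HasDerivAt γ γ' t) :
    HasDerivAt (fun s => u (γ s)) (p * γ' + q * conj γ') t := by
  refine (HasFDerivAt.comp_hasDerivAt t (l := u) hu hγ).congr_deriv ?_
  simp

end HasWirtingerDerivAt

theorem _root_.DifferentiableAt.hasWirtingerDerivAt {u : ℂ → ℂ} {z : ℂ}
    (h : DifferentiableAt ℝ u z) : HasWirtingerDerivAt u (dz u z) (dzbar u z) z :=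
  h.hasFDerivAt.congr_fderiv (eq_wirtingerCLM _)

theorem _root_.HasDerivAt.hasWirtingerDerivAt {h : ℂ → ℂ} {h' z : ℂ} (hh : HasDerivAt h h' z) :
    HasWirtingerDerivAt h h' 0 z := by
  refine (hh.hasFDerivAt.restrictScalars ℝ).congr_fderiv ?_
  ext
  simp [mul_comm]

theorem _root_.HasDerivAt.hasWirtingerDerivAt_conj {h : ℂ → ℂ} {h' z : ℂ}
    (hh : HasDerivAt h h' z) :
    HasWirtingerDerivAt (fun w => conj (h w)) 0 (conj h') z := by
  have := ((Complex.conjCLE : ℂ →L[ℝ] ℂ).hasFDerivAt (x := h z)).comp z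
    (hh.hasFDerivAt.restrictScalars ℝ)
  refine HasFDerivAt.congr_fderiv this ?_
  ext
  simp [mul_comm]

theorem norm_fderiv_le (f : ℂ → ℂ) (z : ℂ) : ‖fderiv ℝ f z‖ ≤ ‖dz f z‖ + ‖dzbar f z‖ := by
  conv_lhs => rw [eq_wirtingerCLM (fderiv ℝ f z)]
  exact norm_wirtingerCLM_le _ _

/-! ### Rotations, rotational averages and Fourier modes -/

/-- `e^{it}` as a function of the angle `t`. -/
def cis (t : ℝ) : ℂ := Complex.exp ((t : ℂ) * Complex.I)

theorem cis_add (s t : ℝ) : cis (s + t) = cis s * cis t := by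
  simp [cis, add_mul, Complex.exp_add]

@[simp] theorem cis_zero : cis 0 = 1 := by simp [cis]

@[simp] theorem norm_cis (t : ℝ) : ‖cis t‖ = 1 := Complex.norm_exp_ofReal_mul_I t

@[simp] theorem cis_ne_zero (t : ℝ) : cis t ≠ 0 := Complex.exp_ne_zero _

@[simp] theorem conj_cis (t : ℝ) : conj (cis t) = cis (-t) := by
  simp [cis, ← Complex.exp_conj]

@[simp] theorem cis_neg_mul_cis (t : ℝ) : cis (-t) * cis t = 1 := by simp [← cis_add]

theorem cis_int_mul (k : ℤ) (t : ℝ) : cis (k * t) = cis t ^ k := by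
  simp [cis, ← Complex.exp_int_mul, mul_assoc]

theorem contDiff_cis {n : WithTop ℕ∞} : ContDiff ℝ n cis := by
  unfold cis
  exact (((Complex.ofRealCLM).contDiff (n := n)).mul contDiff_const).cexp

@[fun_prop]
theorem continuous_cis : Continuous cis := by
  unfold cis
  fun_prop

theorem periodic_cis : Function.Periodic cis (2 * Real.pi) := fun t => by
  rw [cis_add]
  simp [cis, Complex.exp_two_pi_mul_I]

theorem hasDerivAt_cis (t : ℝ) : HasDerivAt cis (Complex.I * cis t) t := by
  have h : HasDerivAt (fun t : ℝ => (t : ℂ) * Complex.I) (1 * Complex.I) t :=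
    (Complex.ofRealCLM.hasDerivAt (x := t)).mul_const _
  refine h.cexp.congr_deriv ?_
  simp [cis, mul_comm]

theorem mem_disc {z : ℂ} : z ∈ disc ↔ ‖z‖ < 1 := by simp [disc]

theorem isOpen_disc : IsOpen disc := Metric.isOpen_ball

theorem mul_cis_mem_disc {z : ℂ} (hz : z ∈ disc) (t : ℝ) : z * cis t ∈ disc := by
  simpa [mem_disc] using hz

theorem ofReal_mem_disc {r : ℝ} (h0 : -1 < r) (h1 : r < 1) : (r : ℂ) ∈ disc := by
  simpa [mem_disc, abs_lt] using ⟨h0, h1⟩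

/-- The average of the rotations of `u` against the weight `κ`. -/
def avg (κ : ℝ → ℂ) (u : ℂ → ℂ) (z : ℂ) : ℂ :=
  ∫ t in (0 : ℝ)..(2 * Real.pi), κ t * u (z * cis t)

theorem continuous_mul_comp_cis {κ : ℝ → ℂ} {u : ℂ → ℂ} (hκ : Continuous κ)
    (hu : ContinuousOn u disc) {z : ℂ} (hz : z ∈ disc) :
    Continuous fun t => κ t * u (z * cis t) :=
  hκ.mul (hu.comp_continuous (by fun_prop) fun t => mul_cis_mem_disc hz t)

theorem continuousOn_avg {κ : ℝ → ℂ} {u : ℂ → ℂ} (hκ : Continuous κ)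
    (hu : ContinuousOn u disc) : ContinuousOn (avg κ u) disc := by
  rw [continuousOn_iff_continuous_domRestrict]
  refine intervalIntegral.continuous_parametric_intervalIntegral_of_continuous'
    (f := fun (z : disc) t => κ t * u (z * cis t)) ?_ _ _
  refine (hκ.comp continuous_snd).mul (hu.comp_continuous (by fun_prop) fun x => ?_)
  exact mul_cis_mem_disc x.1.2 _

theorem hasWirtingerDerivAt_avg {κ : ℝ → ℂ} {u p q : ℂ → ℂ} (hκ : Continuous κ)
    (hp : ContinuousOn p disc) (hq : ContinuousOn q disc)
    (hu : ∀ z ∈ disc, HasWirtingerDerivAt u (p z) (q z) z) {z : ℂ} (hz : z ∈ disc) :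
    HasWirtingerDerivAt (avg κ u) (avg (fun t => κ t * cis t) p z)
      (avg (fun t => κ t * cis (-t)) q z) z := by
  -- An intermediate closed disc, invariant under rotations, supplies the uniform bounds needed to
  -- differentiate under the integral.
  have hz1 : ‖z‖ < 1 := mem_disc.1 hz
  set r := (1 + ‖z‖) / 2 with hr
  have hr1 : r < 1 := by rw [hr]; linarith
  have hzr : ‖z‖ < r := by rw [hr]; linarith
  have hsub : Metric.closedBall (0 : ℂ) r ⊆ disc := fun w hw => by
    rw [mem_disc]; exact (mem_closedBall_zero_iff.1 hw).trans_lt hr1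
  have hucont : ContinuousOn u disc := fun w hw => (hu w hw).continuousAt.continuousWithinAt
  obtain ⟨P, hP⟩ := (isCompact_closedBall (0 : ℂ) r).exists_bound_of_continuousOn (hp.mono hsub)
  obtain ⟨Q, hQ⟩ := (isCompact_closedBall (0 : ℂ) r).exists_bound_of_continuousOn (hq.mono hsub)
  have hs : Metric.ball (0 : ℂ) r ∈ 𝓝 z :=
    Metric.isOpen_ball.mem_nhds (mem_ball_zero_iff.2 hzr)
  have hsd : ∀ w ∈ Metric.ball (0 : ℂ) r, w ∈ disc := fun w hw =>
    hsub (Metric.ball_subset_closedBall hw)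
  have hκ1 : Continuous fun t => κ t * cis t := by fun_prop
  have hκ2 : Continuous fun t => κ t * cis (-t) := by fun_prop
  have cp := continuous_mul_comp_cis hκ1 hp hz
  have cq := continuous_mul_comp_cis hκ2 hq hz
  have cF : Continuous fun t => wirtingerCLM (κ t * cis t * p (z * cis t))
      (κ t * cis (-t) * q (z * cis t)) :=
    continuous_wirtingerCLM.comp (cp.prodMk cq)
  have key := intervalIntegral.hasFDerivAt_integral_of_dominated_of_fderiv_le
    (μ := MeasureTheory.volume) (a := 0) (b := 2 * Real.pi) (𝕜 := ℝ)
    (F := fun w t => κ t * u (w * cis t))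
    (F' := fun w t => wirtingerCLM (κ t * cis t * p (w * cis t)) (κ t * cis (-t) * q (w * cis t)))
    (x₀ := z) (s := Metric.ball 0 r) (bound := fun t => ‖κ t‖ * P + ‖κ t‖ * Q) hs
    (by
      filter_upwards [hs] with w hw
      exact (continuous_mul_comp_cis hκ hucont (hsd w hw)).aestronglyMeasurable)
    ((continuous_mul_comp_cis hκ hucont hz).intervalIntegrable _ _)
    cF.aestronglyMeasurable
    (by
      refine Eventually.of_forall fun t _ w hw => (norm_wirtingerCLM_le _ _).trans ?_
      have hw' : w * cis t ∈ Metric.closedBall (0 : ℂ) r := by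
        have := mem_ball_zero_iff.1 hw
        simpa using this.le
      simp only [norm_mul, norm_cis, mul_one]
      gcongr
      exacts [hP _ hw', hQ _ hw'])
    ((by fun_prop : Continuous fun t => ‖κ t‖ * P + ‖κ t‖ * Q).intervalIntegrable _ _)
    (by
      refine Eventually.of_forall fun t _ w hw => ?_
      have h1 := (hu _ (mul_cis_mem_disc (hsd w hw) t)).comp_hasDerivAt
        (φ := fun w => w * cis t) ((hasDerivAt_id w).mul_const (cis t))
      refine HasFDerivAt.congr_fderiv (h1.const_mul (κ t)) ?_
      simp only [one_mul, conj_cis]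
      congr 1 <;> ring)
  refine HasFDerivAt.congr_fderiv key ?_
  ext h
  rw [ContinuousLinearMap.intervalIntegral_apply (cF.intervalIntegrable _ _)]
  simp only [wirtingerCLM_apply, avg]
  rw [intervalIntegral.integral_add ((cp.mul_const _).intervalIntegrable _ _)
    ((cq.mul_const _).intervalIntegrable _ _), intervalIntegral.integral_mul_const,
    intervalIntegral.integral_mul_const]

/-- The `k`-th Fourier mode of `u` along the circles centred at the origin. -/
def mode (k : ℤ) (u : ℂ → ℂ) : ℂ → ℂ := avg (fun t => cis t ^ (-k)) u

theorem continuous_cis_zpow (k : ℤ) : Continuous fun t => cis t ^ k :=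
  continuous_cis.zpow₀ k fun t => Or.inl (cis_ne_zero t)

theorem continuousOn_mode (k : ℤ) {u : ℂ → ℂ} (hu : ContinuousOn u disc) :
    ContinuousOn (mode k u) disc :=
  continuousOn_avg (continuous_cis_zpow _) hu

theorem hasWirtingerDerivAt_mode (k : ℤ) {u p q : ℂ → ℂ}
    (hp : ContinuousOn p disc) (hq : ContinuousOn q disc)
    (hu : ∀ z ∈ disc, HasWirtingerDerivAt u (p z) (q z) z) {z : ℂ} (hz : z ∈ disc) :
    HasWirtingerDerivAt (mode k u) (mode (k - 1) p z) (mode (k + 1) q z) z := by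
  refine (hasWirtingerDerivAt_avg (continuous_cis_zpow (-k)) hp hq hu hz).congr_deriv ?_ ?_
  · congr 1
    ext t
    rw [neg_sub, sub_eq_neg_add, zpow_add_one₀ (cis_ne_zero t)]
  · congr 1
    ext t
    rw [neg_add, ← sub_eq_add_neg, zpow_sub_one₀ (cis_ne_zero t), ← conj_cis,
      ← Complex.inv_eq_conj (norm_cis t)]

theorem mode_mul_cis (k : ℤ) (u : ℂ → ℂ) (z : ℂ) (s : ℝ) :
    mode k u (z * cis s) = cis (k * s) * mode k u z := by
  have hper : Function.Periodic (fun t => cis t ^ (-k) * u (z * cis t)) (2 * Real.pi) := fun t => by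
    simp only [periodic_cis t]
  have h1 := hper.intervalIntegral_add_eq s 0
  have h2 := intervalIntegral.integral_comp_add_right (a := 0) (b := 2 * Real.pi)
    (fun t => cis t ^ (-k) * u (z * cis t)) s
  rw [zero_add] at h1 h2
  rw [add_comm s] at h1
  simp only [mode, avg]
  rw [← h1, ← h2, ← intervalIntegral.integral_const_mul]
  congr 1
  ext t
  rw [cis_int_mul, cis_add, mul_zpow, mul_assoc z, mul_comm (cis s) (cis t),
    show cis s ^ k * (cis t ^ (-k) * cis s ^ (-k) * u (z * (cis t * cis s)))
      = (cis s ^ k * cis s ^ (-k)) * (cis t ^ (-k) * u (z * (cis t * cis s))) by ring,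
    ← zpow_add₀ (cis_ne_zero s)]
  simp

/-- Differentiating the covariance `mode_mul_cis` in the rotation angle at `0` gives this Euler-type
relation. It allows one of the two Wirtinger derivatives to be eliminated from the radial derivative
of a mode. -/
theorem mode_euler (k : ℤ) {u p q : ℂ → ℂ}
    (hp : ContinuousOn p disc) (hq : ContinuousOn q disc)
    (hu : ∀ z ∈ disc, HasWirtingerDerivAt u (p z) (q z) z) {z : ℂ} (hz : z ∈ disc) :
    z * mode (k - 1) p z - conj z * mode (k + 1) q z = k * mode k u z := by
  have h := hasWirtingerDerivAt_mode k hp hq hu hz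
  have hγ : HasDerivAt (fun s => z * cis s) (z * (Complex.I * cis 0)) 0 :=
    (hasDerivAt_cis 0).const_mul z
  have h1 := HasWirtingerDerivAt.hasDerivAt_comp (γ := fun s => z * cis s) (t := 0)
    (by simpa using h) hγ
  have h2 : HasDerivAt (fun s : ℝ => cis (k * s) * mode k u z)
      (Complex.I * k * mode k u z) 0 := by
    have := ((hasDerivAt_cis (k * 0)).scomp (0 : ℝ)
      ((hasDerivAt_id (0 : ℝ)).const_mul (k : ℝ))).mul_const (mode k u z)
    refine this.congr_deriv ?_
    simp only [mul_zero, cis_zero, mul_one, Complex.real_smul, Complex.ofReal_intCast]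
    ring
  have h3 := h1.unique (h2.congr_of_eventuallyEq
    (Eventually.of_forall fun s => mode_mul_cis k u z s))
  simp at h3
  have hI := Complex.I_ne_zero
  apply mul_left_cancel₀ hI
  linear_combination h3

theorem hasDerivAt_mode_ofReal (k : ℤ) {u p q : ℂ → ℂ}
    (hp : ContinuousOn p disc) (hq : ContinuousOn q disc)
    (hu : ∀ z ∈ disc, HasWirtingerDerivAt u (p z) (q z) z) {r : ℝ} (hr0 : -1 < r) (hr1 : r < 1) :
    HasDerivAt (fun r : ℝ => mode k u r) (mode (k - 1) p r + mode (k + 1) q r) r := by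
  have h := hasWirtingerDerivAt_mode k hp hq hu (ofReal_mem_disc hr0 hr1)
  refine (h.hasDerivAt_comp (γ := fun r : ℝ => (r : ℂ))
    Complex.ofRealCLM.hasDerivAt).congr_deriv ?_
  simp

theorem hasDerivAt_ofReal_zpow (k : ℤ) {r : ℝ} (hr : r ≠ 0) :
    HasDerivAt (fun r : ℝ => (r : ℂ) ^ k) (k * (r : ℂ) ^ (k - 1)) r :=
  (hasDerivAt_zpow k (r : ℂ) (Or.inl (by exact_mod_cast hr))).comp_ofReal

/-- The power `r ^ (-k)` is the integrating factor that removes `p`. It is applied to `f`, whose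
`z̄`-derivative is the weighted `F`. -/
theorem hasDerivAt_zpow_neg_mul_mode (k : ℤ) {u p q : ℂ → ℂ}
    (hp : ContinuousOn p disc) (hq : ContinuousOn q disc)
    (hu : ∀ z ∈ disc, HasWirtingerDerivAt u (p z) (q z) z) {r : ℝ} (hr0 : 0 < r) (hr1 : r < 1) :
    HasDerivAt (fun r : ℝ => (r : ℂ) ^ (-k) * mode k u r)
      (2 * (r : ℂ) ^ (-k) * mode (k + 1) q r) r := by
  have hr : (r : ℂ) ≠ 0 := by exact_mod_cast hr0.ne'
  have h := (hasDerivAt_ofReal_zpow (-k) hr0.ne').mul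
    (hasDerivAt_mode_ofReal k hp hq hu (by linarith) hr1)
  refine h.congr_deriv ?_
  have he := mode_euler k hp hq hu (ofReal_mem_disc (by linarith) hr1)
  rw [Complex.conj_ofReal] at he
  rw [zpow_sub_one₀ hr]
  push_cast
  field_simp
  linear_combination he

/-- The dual integrating factor, removing `q`. It is applied to `F`, whose `z`-derivative is the
given `g`. -/
theorem hasDerivAt_zpow_mul_mode (k : ℤ) {u p q : ℂ → ℂ}
    (hp : ContinuousOn p disc) (hq : ContinuousOn q disc)
    (hu : ∀ z ∈ disc, HasWirtingerDerivAt u (p z) (q z) z) {r : ℝ} (hr0 : 0 < r) (hr1 : r < 1) :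
    HasDerivAt (fun r : ℝ => (r : ℂ) ^ k * mode k u r)
      (2 * (r : ℂ) ^ k * mode (k - 1) p r) r := by
  have hr : (r : ℂ) ≠ 0 := by exact_mod_cast hr0.ne'
  have h := (hasDerivAt_ofReal_zpow k hr0.ne').mul
    (hasDerivAt_mode_ofReal k hp hq hu (by linarith) hr1)
  refine h.congr_deriv ?_
  have he := mode_euler k hp hq hu (ofReal_mem_disc (by linarith) hr1)
  rw [Complex.conj_ofReal] at he
  rw [zpow_sub_one₀ hr]
  field_simp
  linear_combination -he

/-! ### The first-order system -/

/-- A continuously differentiable function `f` on the disc with `∂f/∂z = p` and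
`∂f/∂z̄ = (1 - |z|²)^α F`, where `F` is continuously differentiable with `∂F/∂z = g` and
`∂F/∂z̄ = q`. -/
structure WeightedSystem (α : ℝ) (f p F g q : ℂ → ℂ) : Prop where
  deriv_left : ∀ z ∈ disc,
    HasWirtingerDerivAt f (p z) (((1 - ‖z‖ ^ 2 : ℝ) ^ α : ℝ) * F z) z
  deriv_right : ∀ z ∈ disc, HasWirtingerDerivAt F (g z) (q z) z
  continuousOn_p : ContinuousOn p disc
  continuousOn_g : ContinuousOn g disc
  continuousOn_q : ContinuousOn q disc

theorem one_sub_normSq_pos {z : ℂ} (hz : z ∈ disc) : 0 < 1 - ‖z‖ ^ 2 := by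
  have := mem_disc.1 hz
  nlinarith [norm_nonneg z]

theorem continuousOn_weight (α : ℝ) :
    ContinuousOn (fun z : ℂ => (((1 - ‖z‖ ^ 2 : ℝ) ^ α : ℝ) : ℂ)) disc := by
  refine Complex.continuous_ofReal.comp_continuousOn ?_
  exact ContinuousOn.rpow_const (by fun_prop) fun z hz => Or.inl (one_sub_normSq_pos hz).ne'

namespace WeightedSystem

variable {α : ℝ} {f p F g q : ℂ → ℂ}

theorem continuousOn_f (h : WeightedSystem α f p F g q) : ContinuousOn f disc :=
  fun z hz => (h.deriv_left z hz).continuousAt.continuousWithinAt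

theorem continuousOn_F (h : WeightedSystem α f p F g q) : ContinuousOn F disc :=
  fun z hz => (h.deriv_right z hz).continuousAt.continuousWithinAt

theorem continuousOn_dzbar (h : WeightedSystem α f p F g q) :
    ContinuousOn (fun z => (((1 - ‖z‖ ^ 2 : ℝ) ^ α : ℝ) : ℂ) * F z) disc :=
  (continuousOn_weight α).mul h.continuousOn_F

end WeightedSystem

/-! ### Disc automorphisms and weighted invariance -/

/-- The denominator `1 + ā z` of the disc automorphism sending `0` to `a`. -/
def mobiusDen (a z : ℂ) : ℂ := 1 + conj a * z

/-- The disc automorphism `z ↦ (z + a) / (1 + ā z)`. -/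
def mobius (a z : ℂ) : ℂ := (z + a) / mobiusDen a z

section Mobius

variable {a z : ℂ}

theorem norm_mul_lt_one (ha : a ∈ disc) (hz : z ∈ disc) : ‖conj a * z‖ < 1 := by
  rw [norm_mul, RCLike.norm_conj]
  have h1 := mem_disc.1 ha
  have h2 := mem_disc.1 hz
  nlinarith [norm_nonneg a, norm_nonneg z]

theorem mobiusDen_mem_slitPlane (ha : a ∈ disc) (hz : z ∈ disc) :
    mobiusDen a z ∈ Complex.slitPlane :=
  Complex.mem_slitPlane_of_norm_lt_one (norm_mul_lt_one ha hz)

theorem mobiusDen_ne_zero (ha : a ∈ disc) (hz : z ∈ disc) : mobiusDen a z ≠ 0 :=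
  Complex.slitPlane_ne_zero (mobiusDen_mem_slitPlane ha hz)

theorem norm_mobiusDen_pos (ha : a ∈ disc) (hz : z ∈ disc) : 0 < ‖mobiusDen a z‖ :=
  norm_pos_iff.2 (mobiusDen_ne_zero ha hz)

theorem norm_mobiusDen_le (ha : a ∈ disc) (hz : z ∈ disc) : ‖mobiusDen a z‖ ≤ 2 := by
  refine (norm_add_le _ _).trans ?_
  have := norm_mul_lt_one ha hz
  rw [norm_one]
  linarith

theorem one_sub_norm_le_norm_mobiusDen (hz : z ∈ disc) :
    1 - ‖a‖ ≤ ‖mobiusDen a z‖ := by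
  have h1 : ‖conj a * z‖ ≤ ‖a‖ := by
    rw [norm_mul, RCLike.norm_conj]
    exact mul_le_of_le_one_right (norm_nonneg _) (mem_disc.1 hz).le
  have h2 := norm_sub_norm_le (1 : ℂ) (-(conj a * z))
  rw [norm_neg, norm_one, sub_neg_eq_add] at h2
  exact le_trans (by linarith) h2

/-- The source of `one_sub_normSq_mobius` and of two lower bounds for `|1 + ā z|`: by `|z + a|`, and
for its square by `(1 - |z|²)(1 - |a|²)`. -/
theorem normSq_mobiusDen_sub (a z : ℂ) :
    ‖mobiusDen a z‖ ^ 2 - ‖z + a‖ ^ 2 = (1 - ‖z‖ ^ 2) * (1 - ‖a‖ ^ 2) := by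
  simp only [← Complex.normSq_eq_norm_sq, mobiusDen, Complex.normSq_apply]
  simp
  ring

theorem one_sub_normSq_mobius (ha : a ∈ disc) (hz : z ∈ disc) :
    1 - ‖mobius a z‖ ^ 2 = (1 - ‖z‖ ^ 2) * (1 - ‖a‖ ^ 2) / ‖mobiusDen a z‖ ^ 2 := by
  have := norm_mobiusDen_pos ha hz
  rw [← normSq_mobiusDen_sub, mobius, norm_div]
  field_simp

theorem mobius_mem_disc (ha : a ∈ disc) (hz : z ∈ disc) : mobius a z ∈ disc := by
  have h := one_sub_normSq_mobius ha hz
  have h1 : 0 < 1 - ‖mobius a z‖ ^ 2 := by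
    rw [h]
    exact div_pos (mul_pos (one_sub_normSq_pos hz) (one_sub_normSq_pos ha))
      (pow_pos (norm_mobiusDen_pos ha hz) 2)
  rw [mem_disc]
  nlinarith [norm_nonneg (mobius a z)]

theorem mul_le_normSq_mobiusDen (a z : ℂ) :
    (1 - ‖z‖ ^ 2) * (1 - ‖a‖ ^ 2) ≤ ‖mobiusDen a z‖ ^ 2 := by
  rw [← normSq_mobiusDen_sub]
  nlinarith [sq_nonneg ‖z + a‖]

theorem norm_conj_add_le_norm_mobiusDen (ha : a ∈ disc) (hz : z ∈ disc) :
    ‖conj z + conj a‖ ≤ ‖mobiusDen a z‖ := by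
  have h := normSq_mobiusDen_sub a z
  have h1 := mul_pos (one_sub_normSq_pos hz) (one_sub_normSq_pos ha)
  rw [← map_add, RCLike.norm_conj]
  nlinarith [norm_nonneg (z + a), norm_nonneg (mobiusDen a z)]

theorem hasDerivAt_mobiusDen (a z : ℂ) : HasDerivAt (mobiusDen a) (conj a) z := by
  refine (((hasDerivAt_id z).const_mul (conj a)).const_add 1).congr_deriv ?_
  simp

theorem hasDerivAt_mobius (ha : a ∈ disc) (hz : z ∈ disc) :
    HasDerivAt (mobius a) ((1 - ‖a‖ ^ 2 : ℝ) / mobiusDen a z ^ 2) z := by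
  have h := ((hasDerivAt_id z).add_const a).div (hasDerivAt_mobiusDen a z)
    (mobiusDen_ne_zero ha hz)
  refine h.congr_deriv ?_
  congr 1
  have := Complex.conj_mul' a
  push_cast
  rw [← this, mobiusDen]
  simp
  ring

theorem differentiableOn_mobius (ha : a ∈ disc) : DifferentiableOn ℂ (mobius a) disc :=
  fun _ hz => (hasDerivAt_mobius ha hz).differentiableAt.differentiableWithinAt

theorem continuousOn_mobius (ha : a ∈ disc) : ContinuousOn (mobius a) disc :=
  (differentiableOn_mobius ha).continuousOn

theorem continuous_mobiusDen (a : ℂ) : Continuous (mobiusDen a) := by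
  unfold mobiusDen
  fun_prop

theorem continuousOn_mobiusDen_cpow (ha : a ∈ disc) (c : ℂ) :
    ContinuousOn (fun z => mobiusDen a z ^ c) disc :=
  (continuous_mobiusDen a).continuousOn.cpow_const fun _ hz =>
    mobiusDen_mem_slitPlane ha hz

theorem continuousOn_comp_mobius (ha : a ∈ disc) {u : ℂ → ℂ} (hu : ContinuousOn u disc) :
    ContinuousOn (fun z => u (mobius a z)) disc :=
  hu.comp (continuousOn_mobius ha) fun _ hz => mobius_mem_disc ha hz

theorem hasDerivAt_mobiusDen_cpow (ha : a ∈ disc) (hz : z ∈ disc) (c : ℂ) :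
    HasDerivAt (fun z => mobiusDen a z ^ c) (c * mobiusDen a z ^ (c - 1) * conj a) z :=
  (hasDerivAt_mobiusDen a z).cpow_const (mobiusDen_mem_slitPlane ha hz)

/-- The derivative of the disc automorphism `mobius a`. -/
def mobiusDeriv (a z : ℂ) : ℂ := (1 - ‖a‖ ^ 2 : ℝ) / mobiusDen a z ^ 2

/-- The holomorphic factor by which `(1 - |z|²)^(-α) ∂f/∂z̄` changes (after conjugation) under the
weighted change of variables. -/
def mobiusFactor (α : ℝ) (a z : ℂ) : ℂ :=
  ((1 - ‖a‖ ^ 2 : ℝ) ^ α : ℝ) * mobiusDen a z ^ (-(α : ℂ)) * mobiusDeriv a z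

theorem continuousOn_mobiusDeriv (ha : a ∈ disc) : ContinuousOn (mobiusDeriv a) disc :=
  continuousOn_const.div ((continuous_mobiusDen a).pow 2).continuousOn fun _ hz =>
    pow_ne_zero 2 (mobiusDen_ne_zero ha hz)

theorem differentiableOn_mobiusFactor (α : ℝ) (ha : a ∈ disc) :
    DifferentiableOn ℂ (mobiusFactor α a) disc := fun z hz => by
  refine DifferentiableAt.differentiableWithinAt ?_
  refine DifferentiableAt.mul (DifferentiableAt.const_mul
    (hasDerivAt_mobiusDen_cpow ha hz _).differentiableAt _) ?_
  exact (differentiableAt_const _).div ((hasDerivAt_mobiusDen a z).differentiableAt.pow 2)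
    (pow_ne_zero 2 (mobiusDen_ne_zero ha hz))

/-- With `w = 1 + ā z`, `|w|^(2α) = w^α · conj (w^α)`; the principal branch is legitimate because
`Re w > 0`. -/
theorem cpow_mul_conj_cpow (ha : a ∈ disc) (hz : z ∈ disc) (α : ℝ) :
    ((‖mobiusDen a z‖ ^ 2 : ℝ) ^ α : ℝ) * conj (mobiusDen a z ^ (-(α : ℂ)))
      = mobiusDen a z ^ (α : ℂ) := by
  have h0 := mobiusDen_ne_zero ha hz
  have h1 : ((‖mobiusDen a z‖ ^ 2 : ℝ) ^ α : ℝ) = ‖mobiusDen a z ^ (α : ℂ)‖ ^ 2 := by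
    rw [Complex.norm_cpow_real, ← Real.rpow_natCast_mul (norm_nonneg _),
      ← Real.rpow_mul_natCast (norm_nonneg _), mul_comm]
  rw [h1, Complex.ofReal_pow, ← Complex.mul_conj', mul_assoc, ← map_mul,
    ← Complex.cpow_add _ _ h0]
  simp

/-- Transforming the weight produces `|1 + ā z|^(-2α)`. The factor `(1 + ā z)^α` in front of the
composition cancels the holomorphic half of it, so what remains besides the weight is
antiholomorphic. -/
theorem weight_mobius (ha : a ∈ disc) (hz : z ∈ disc) (α : ℝ) :
    mobiusDen a z ^ (α : ℂ) * (((1 - ‖mobius a z‖ ^ 2 : ℝ) ^ α : ℝ) * conj (mobiusDeriv a z))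
      = ((1 - ‖z‖ ^ 2 : ℝ) ^ α : ℝ) * conj (mobiusFactor α a z) := by
  have hp := norm_mobiusDen_pos ha hz
  rw [one_sub_normSq_mobius ha hz, ← cpow_mul_conj_cpow ha hz, Real.div_rpow
    (mul_pos (one_sub_normSq_pos hz) (one_sub_normSq_pos ha)).le (by positivity),
    Real.mul_rpow (one_sub_normSq_pos hz).le (one_sub_normSq_pos ha).le]
  have hne : ((‖mobiusDen a z‖ ^ 2 : ℝ) ^ α : ℝ) ≠ 0 := (Real.rpow_pos_of_pos (by positivity) _).ne'
  generalize ((‖mobiusDen a z‖ ^ 2 : ℝ) ^ α : ℝ) = y at *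
  have hne' : (y : ℂ) ≠ 0 := by exact_mod_cast hne
  simp only [mobiusFactor, map_mul, Complex.conj_ofReal]
  push_cast
  field_simp

end Mobius

/-- The weighted composition of a solution with a disc automorphism is again a solution. -/
theorem WeightedSystem.comp_mobius {α : ℝ} {f p F g q : ℂ → ℂ}
    (h : WeightedSystem α f p F g q) {a : ℂ} (ha : a ∈ disc) :
    WeightedSystem α (fun z => mobiusDen a z ^ (α : ℂ) * f (mobius a z))
      (fun z => α * mobiusDen a z ^ ((α : ℂ) - 1) * conj a * f (mobius a z)
        + mobiusDen a z ^ (α : ℂ) * (p (mobius a z) * mobiusDeriv a z))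
      (fun z => F (mobius a z) * conj (mobiusFactor α a z))
      (fun z => g (mobius a z) * mobiusDeriv a z * conj (mobiusFactor α a z))
      (fun z => q (mobius a z) * conj (mobiusDeriv a z) * conj (mobiusFactor α a z)
        + F (mobius a z) * conj (deriv (mobiusFactor α a) z)) where
  deriv_left z hz := by
    have h1 := (h.deriv_left _ (mobius_mem_disc ha hz)).comp_hasDerivAt (hasDerivAt_mobius ha hz)
    refine ((hasDerivAt_mobiusDen_cpow ha hz α).hasWirtingerDerivAt.mul h1).congr_deriv rfl ?_
    have h2 := weight_mobius ha hz α
    rw [mobiusDeriv] at h2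
    linear_combination F (mobius a z) * h2
  deriv_right z hz := by
    have h1 := (h.deriv_right _ (mobius_mem_disc ha hz)).comp_hasDerivAt (hasDerivAt_mobius ha hz)
    -- The conjugated factor is antiholomorphic, so it passes through `∂/∂z` and the new right-hand
    -- side contains no `F`.
    have h2 := ((differentiableOn_mobiusFactor α ha).differentiableAt
      (isOpen_disc.mem_nhds hz)).hasDerivAt.hasWirtingerDerivAt_conj
    refine (h1.mul h2).congr_deriv ?_ rfl
    simp [mobiusDeriv]
  continuousOn_p := by
    have h1 := continuousOn_mobiusDen_cpow ha (α - 1 : ℂ)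
    have h2 := continuousOn_mobiusDen_cpow ha (α : ℂ)
    have h3 := continuousOn_comp_mobius ha h.continuousOn_f
    have h4 := continuousOn_comp_mobius ha h.continuousOn_p
    have h5 := continuousOn_mobiusDeriv ha
    exact (((continuousOn_const.mul h1).mul continuousOn_const).mul h3).add (h2.mul (h4.mul h5))
  continuousOn_g := by
    have h4 := continuousOn_comp_mobius ha h.continuousOn_g
    have h5 := continuousOn_mobiusDeriv ha
    have h6 := Complex.continuous_conj.comp_continuousOn
      (differentiableOn_mobiusFactor α ha).continuousOn
    exact (h4.mul h5).mul h6
  continuousOn_q := by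
    have h3 := continuousOn_comp_mobius ha h.continuousOn_F
    have h4 := continuousOn_comp_mobius ha h.continuousOn_q
    have h5 := Complex.continuous_conj.comp_continuousOn (continuousOn_mobiusDeriv ha)
    have h6 := Complex.continuous_conj.comp_continuousOn
      (differentiableOn_mobiusFactor α ha).continuousOn
    have h7 := Complex.continuous_conj.comp_continuousOn
      ((differentiableOn_mobiusFactor α ha).deriv isOpen_disc).continuousOn
    exact ((h4.mul h5).mul h6).add (h3.mul h7)

/-! ### Modes near the origin -/

theorem mode_zero_eq (u : ℂ → ℂ) : mode 0 u 0 = 2 * Real.pi * u 0 := by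
  simp [mode, avg]

theorem mode_apply_zero {k : ℤ} (hk : k ≠ 0) (u : ℂ → ℂ) : mode k u 0 = 0 := by
  -- Rotating the origin by the angle `π / k` fixes it but multiplies the mode by `-1`.
  have h := mode_mul_cis k u 0 (Real.pi / k)
  have hk' : (k : ℝ) ≠ 0 := by exact_mod_cast hk
  rw [zero_mul, mul_div_cancel₀ _ hk', cis, Complex.exp_pi_mul_I] at h
  linear_combination h / 2

theorem mode_weight (k : ℤ) (α : ℝ) (F : ℂ → ℂ) (s : ℝ) :
    mode k (fun z => (((1 - ‖z‖ ^ 2 : ℝ) ^ α : ℝ) : ℂ) * F z) s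
      = ((1 - s ^ 2 : ℝ) ^ α : ℝ) * mode k F s := by
  simp only [mode, avg]
  rw [← intervalIntegral.integral_const_mul]
  congr 1
  ext t
  rw [norm_mul, norm_cis, mul_one, Complex.norm_real, Real.norm_eq_abs, sq_abs]
  ring

theorem tendsto_mode_zero (k : ℤ) {u : ℂ → ℂ} (hu : ContinuousOn u disc) :
    Tendsto (fun s : ℝ => mode k u s) (𝓝[>] 0) (𝓝 (mode k u 0)) := by
  have h0 : (0 : ℂ) ∈ disc := by simp [mem_disc]
  have h := ((continuousOn_mode k hu).continuousAt (isOpen_disc.mem_nhds h0)).tendsto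
  refine h.comp ?_
  have : Tendsto (fun s : ℝ => (s : ℂ)) (𝓝 0) (𝓝 ((0 : ℝ) : ℂ)) :=
    Complex.continuous_ofReal.tendsto 0
  simpa using this.mono_left nhdsWithin_le_nhds

/-- The quotient is a difference quotient at `0`, since the first mode vanishes there; of its
derivative `mode 0 p + mode 2 q` only the first term survives at the origin. -/
theorem tendsto_inv_mul_mode_one {u p q : ℂ → ℂ}
    (hp : ContinuousOn p disc) (hq : ContinuousOn q disc)
    (hu : ∀ z ∈ disc, HasWirtingerDerivAt u (p z) (q z) z) :
    Tendsto (fun s : ℝ => (s : ℂ)⁻¹ * mode 1 u s) (𝓝[>] 0) (𝓝 (2 * Real.pi * p 0)) := by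
  have h := (hasDerivAt_mode_ofReal 1 hp hq hu (r := 0) (by norm_num) (by norm_num))
  have h1 := h.tendsto_slope_zero_right
  simp only [zero_add, Complex.ofReal_zero, mode_apply_zero one_ne_zero, sub_zero, sub_self,
    mode_zero_eq] at h1
  rw [show (1 + 1 : ℤ) = 2 by norm_num, mode_apply_zero two_ne_zero, add_zero] at h1
  refine h1.congr fun s => ?_
  simp

/-! ### Radial kernels -/

section Kernels

variable {α R s : ℝ}

/-- The kernel `∫_s^R 2 (1 - r²)^α / r dr`. -/
def logKernel (α R s : ℝ) : ℝ := ∫ r in s..R, 2 * (1 - r ^ 2) ^ α / r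

/-- The kernel `(1 - s²)^(α+1) / s²`. -/
def polarKernel (α s : ℝ) : ℝ := (1 - s ^ 2) ^ (α + 1) / s ^ 2

@[simp] theorem logKernel_self (α R : ℝ) : logKernel α R R = 0 := by simp [logKernel]

theorem one_sub_sq_pos (h0 : 0 < s) (h1 : s < 1) : 0 < 1 - s ^ 2 := by nlinarith

theorem continuousAt_logKernel_integrand (h0 : 0 < s) (h1 : s < 1) :
    ContinuousAt (fun r : ℝ => 2 * (1 - r ^ 2) ^ α / r) s := by
  have := one_sub_sq_pos h0 h1
  refine ContinuousAt.div (continuousAt_const.mul (ContinuousAt.rpow_const (by fun_prop)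
    (Or.inl this.ne'))) continuousAt_id h0.ne'

theorem hasDerivAt_logKernel (h0 : 0 < s) (hs : s < 1) (hR0 : 0 < R) (hR : R < 1) :
    HasDerivAt (logKernel α R) (-(2 * (1 - s ^ 2) ^ α / s)) s := by
  have hc : ContinuousOn (fun r : ℝ => 2 * (1 - r ^ 2) ^ α / r) (Ioo 0 1) := fun r hr =>
    (continuousAt_logKernel_integrand hr.1 hr.2).continuousWithinAt
  have hsub : uIcc s R ⊆ Ioo 0 1 := fun r hr => by
    rw [mem_uIcc] at hr
    constructor <;> rcases hr with h | h <;> linarith [h.1, h.2]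
  exact intervalIntegral.integral_hasDerivAt_left ((hc.mono hsub).intervalIntegrable)
    (hc.stronglyMeasurableAtFilter isOpen_Ioo s ⟨h0, hs⟩) (continuousAt_logKernel_integrand h0 hs)

theorem hasDerivAt_one_sub_sq_rpow (h0 : 0 < s) (h1 : s < 1) (β : ℝ) :
    HasDerivAt (fun s : ℝ => (1 - s ^ 2) ^ (β + 1)) (-(2 * s * (β + 1) * (1 - s ^ 2) ^ β)) s := by
  have h := (((hasDerivAt_id s).pow 2).const_sub 1).rpow_const (p := β + 1)
    (Or.inl (one_sub_sq_pos h0 h1).ne')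
  refine h.congr_deriv ?_
  simp

theorem hasDerivAt_polarKernel (h0 : 0 < s) (h1 : s < 1) :
    HasDerivAt (polarKernel α)
      (-(2 * (1 - s ^ 2) ^ α / s ^ 3) - α * (2 * (1 - s ^ 2) ^ α / s)) s := by
  have h := (hasDerivAt_one_sub_sq_rpow h0 h1 α).div ((hasDerivAt_id s).pow 2) (by simp [h0.ne'])
  refine h.congr_deriv ?_
  rw [Real.rpow_add_one (one_sub_sq_pos h0 h1).ne']
  simp
  field_simp
  ring

theorem polarKernel_nonneg (h1 : s < 1) (h0 : 0 < s) : 0 ≤ polarKernel α s :=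
  div_nonneg (Real.rpow_nonneg (one_sub_sq_pos h0 h1).le _) (by positivity)

theorem polarKernel_anti (hα : 0 ≤ α) (h0 : 0 < s) (hsR : s ≤ R) (hR : R < 1) :
    polarKernel α R ≤ polarKernel α s := by
  refine div_le_div₀ (Real.rpow_nonneg (one_sub_sq_pos h0 (hsR.trans_lt hR)).le _)
    (Real.rpow_le_rpow (one_sub_sq_pos (h0.trans_le hsR) hR).le ?_ (by linarith)) (by positivity)
    ?_ <;> nlinarith

theorem logKernel_nonneg (h0 : 0 < s) (hsR : s ≤ R) (hR : R < 1) : 0 ≤ logKernel α R s := by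
  refine intervalIntegral.integral_nonneg hsR fun r hr => ?_
  have hr0 : 0 < r := h0.trans_le hr.1
  have := one_sub_sq_pos hr0 (hr.2.trans_lt hR)
  positivity

/-- The difference `s * polarKernel α s - logKernel α R s` decreases on `(0, R]` and is nonnegative
at `R`. Up to a positive factor, its derivative is `-((1 - r)² + 2 α r²)`. -/
theorem logKernel_le (hα : 0 ≤ α) (h0 : 0 < s) (hsR : s ≤ R) (hR : R < 1) :
    logKernel α R s ≤ s * polarKernel α s := by
  have hderiv : ∀ r ∈ Icc s R, HasDerivAt (fun r => r * polarKernel α r - logKernel α R r)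
      (1 * polarKernel α r + r * (-(2 * (1 - r ^ 2) ^ α / r ^ 3) - α * (2 * (1 - r ^ 2) ^ α / r))
        - -(2 * (1 - r ^ 2) ^ α / r)) r := fun r hr => by
    have hr0 : 0 < r := h0.trans_le hr.1
    have hr1 : r < 1 := hr.2.trans_lt hR
    exact ((hasDerivAt_id r).mul (hasDerivAt_polarKernel hr0 hr1)).sub
      (hasDerivAt_logKernel hr0 hr1 (hr0.trans_le hr.2) hR)
  have hanti : AntitoneOn (fun r => r * polarKernel α r - logKernel α R r) (Icc s R) := by
    refine antitoneOn_of_deriv_nonpos (convex_Icc s R)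
      (fun r hr => (hderiv r hr).continuousAt.continuousWithinAt)
      (fun r hr => (hderiv r (interior_subset hr)).differentiableAt.differentiableWithinAt)
      fun r hr => ?_
    have hr' := interior_subset hr
    rw [(hderiv r hr').deriv]
    have hr0 : 0 < r := h0.trans_le hr'.1
    have h1 := one_sub_sq_pos hr0 (hr'.2.trans_lt hR)
    have h2 : 0 < (1 - r ^ 2) ^ α := Real.rpow_pos_of_pos h1 α
    rw [polarKernel, Real.rpow_add_one h1.ne']
    generalize (1 - r ^ 2) ^ α = y at h2
    have : 1 * (y * (1 - r ^ 2) / r ^ 2) + r * (-(2 * y / r ^ 3) - α * (2 * y / r)) - -(2 * y / r)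
        = -(y * ((1 - r) ^ 2 + 2 * α * r ^ 2) / r ^ 2) := by
      field_simp
      ring
    rw [this]
    have : 0 ≤ y * ((1 - r) ^ 2 + 2 * α * r ^ 2) / r ^ 2 := by positivity
    linarith
  have h := hanti ⟨le_rfl, hsR⟩ ⟨hsR, le_rfl⟩ hsR
  simp only [logKernel_self] at h
  have := mul_nonneg (h0.trans_le hsR).le (polarKernel_nonneg (α := α) hR (h0.trans_le hsR))
  linarith

end Kernels

/-! ### Radial representation of the derivatives at the origin -/

/-- A mean value inequality on `(0, R]` with a limit at the left end point. -/
theorem norm_sub_le_of_tendsto_zero {Φ Φ' : ℝ → ℂ} {N N' : ℝ → ℝ} {L : ℂ} {R : ℝ} (hR : 0 < R)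
    (hΦ : ∀ s ∈ Ioc 0 R, HasDerivAt Φ (Φ' s) s) (hN : ∀ s ∈ Icc 0 R, HasDerivAt N (N' s) s)
    (hle : ∀ s ∈ Ioc 0 R, ‖Φ' s‖ ≤ N' s) (hL : Tendsto Φ (𝓝[>] 0) (𝓝 L)) :
    ‖Φ R - L‖ ≤ N R - N 0 := by
  have hN0 : Tendsto N (𝓝[>] 0) (𝓝 (N 0)) :=
    (hN 0 ⟨le_rfl, hR.le⟩).continuousAt.tendsto.mono_left nhdsWithin_le_nhds
  refine le_of_tendsto_of_tendsto ((tendsto_const_nhds.sub hL).norm)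
    (tendsto_const_nhds.sub hN0) ?_
  filter_upwards [Ioo_mem_nhdsGT hR] with ε hε
  have hsub : ∀ s ∈ Icc ε R, s ∈ Ioc 0 R := fun s hs => ⟨hε.1.trans_le hs.1, hs.2⟩
  have h := image_norm_le_of_norm_deriv_right_le_deriv_boundary' (f := fun s => Φ s - Φ ε)
    (f' := Φ') (a := ε) (b := R) (B := fun s => N s - N ε) (B' := N')
    (fun s hs => ((hΦ s (hsub s hs)).sub_const _).continuousAt.continuousWithinAt)
    (fun s hs => ((hΦ s (hsub s ⟨hs.1, hs.2.le⟩)).sub_const _).hasDerivWithinAt) (by simp)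
    (fun s hs => ((hN s (Ioc_subset_Icc_self (hsub s hs))).sub_const
      _).continuousAt.continuousWithinAt)
    (fun s hs => ((hN s (Ioc_subset_Icc_self (hsub s ⟨hs.1, hs.2.le⟩))).sub_const
      _).hasDerivWithinAt)
    (fun s hs => hle s (hsub s ⟨hs.1, hs.2.le⟩))
  exact h ⟨hε.2.le, le_rfl⟩

namespace WeightedSystem

variable {α : ℝ} {f p F g q : ℂ → ℂ} {R s : ℝ}

/-- The radial function whose value near `0` is `2π (∂f/∂z(0) + c f(0))`. -/
def radialDz (α R : ℝ) (c : ℂ) (f F : ℂ → ℂ) (s : ℝ) : ℂ :=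
  (s : ℂ)⁻¹ * mode 1 f s
    + ((polarKernel α s - polarKernel α R - α * logKernel α R s : ℝ) : ℂ) * (s ^ 2 * mode 2 F s)
    + c * (mode 0 f s + (logKernel α R s : ℂ) * (s * mode 1 F s))

/-- The coefficient of `s² * mode 2 F` has derivative `-2 (1 - s²)^α / s³`, the `α / s` terms
cancelling. This offsets the derivative of `s⁻¹ * mode 1 f`. Likewise the derivative of `logKernel`
offsets that of `mode 0 f`, so only modes of `g` are left. -/
theorem hasDerivAt_radialDz (h : WeightedSystem α f p F g q) (c : ℂ) (hs0 : 0 < s) (hs1 : s < 1)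
    (hR0 : 0 < R) (hR1 : R < 1) :
    HasDerivAt (radialDz α R c f F)
      (2 * s * (s * (polarKernel α s - polarKernel α R - α * logKernel α R s : ℝ) * mode 1 g s
        + c * logKernel α R s * mode 0 g s)) s := by
  have hs : (s : ℂ) ≠ 0 := by exact_mod_cast hs0.ne'
  have h1 := hasDerivAt_zpow_neg_mul_mode 1 h.continuousOn_p h.continuousOn_dzbar h.deriv_left
    hs0 hs1
  have h0 := hasDerivAt_zpow_neg_mul_mode 0 h.continuousOn_p h.continuousOn_dzbar h.deriv_left
    hs0 hs1
  have h2 := hasDerivAt_zpow_mul_mode 2 h.continuousOn_g h.continuousOn_q h.deriv_right hs0 hs1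
  have h3 := hasDerivAt_zpow_mul_mode 1 h.continuousOn_g h.continuousOn_q h.deriv_right hs0 hs1
  have hl := hasDerivAt_logKernel (α := α) hs0 hs1 hR0 hR1
  have hA := ((hasDerivAt_polarKernel (α := α) hs0 hs1).sub_const (polarKernel α R)).sub
    (hl.const_mul α)
  have key := (h1.add (hA.ofReal_comp.mul h2)).add
    ((h0.add (hl.ofReal_comp.mul h3)).const_mul c)
  simp only [zpow_neg, neg_zero, mode_weight, zpow_ofNat] at key
  norm_num at key
  refine (key.congr_deriv ?_).congr_of_eventuallyEq (Eventually.of_forall fun r => ?_)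
  · push_cast
    field_simp
    ring
  · simp [radialDz]

theorem tendsto_radialDz (h : WeightedSystem α f p F g q) (hα : 0 ≤ α) (c : ℂ)
    (hR0 : 0 < R) (hR1 : R < 1) :
    Tendsto (radialDz α R c f F) (𝓝[>] 0) (𝓝 (2 * Real.pi * (p 0 + c * f 0))) := by
  have h1 := tendsto_inv_mul_mode_one h.continuousOn_p h.continuousOn_dzbar h.deriv_left
  have h0 := tendsto_mode_zero 0 h.continuousOn_f
  have h2 := tendsto_mode_zero 2 h.continuousOn_F
  have h3 := tendsto_mode_zero 1 h.continuousOn_F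
  rw [mode_apply_zero two_ne_zero] at h2
  rw [mode_apply_zero one_ne_zero] at h3
  rw [mode_zero_eq] at h0
  have hmem : Ioo 0 R ∈ 𝓝[>] (0 : ℝ) := Ioo_mem_nhdsGT hR0
  -- `s² * polarKernel` and `s * logKernel` stay bounded near `0`, so the kernel terms are
  -- controlled by `mode 2 F` and `mode 1 F`, which vanish at the origin.
  have hpol : ∀ s ∈ Ioo 0 R, s ^ 2 * polarKernel α s ≤ 1 := fun s hs => by
    have : s ^ 2 * polarKernel α s = (1 - s ^ 2) ^ (α + 1) := by
      rw [polarKernel]; field_simp [hs.1.ne']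
    rw [this]
    exact Real.rpow_le_one (one_sub_sq_pos hs.1 (hs.2.trans hR1)).le (by nlinarith [hs.1])
      (by linarith)
  have hlog : ∀ s ∈ Ioo 0 R, s * logKernel α R s ≤ 1 := fun s hs => by
    have := logKernel_le hα hs.1 hs.2.le hR1
    have := mul_le_mul_of_nonneg_left this hs.1.le
    have := hpol s hs
    nlinarith
  have hA : Tendsto (fun s : ℝ => ((polarKernel α s - polarKernel α R - α * logKernel α R s : ℝ) : ℂ)
      * (s ^ 2 * mode 2 F s)) (𝓝[>] 0) (𝓝 0) := by
    refine squeeze_zero_norm' (a := fun s : ℝ => (1 + α) * ‖mode 2 F s‖) ?_ ?_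
    · filter_upwards [hmem] with s hs
      have e1 := hpol s hs
      have e2 := hlog s hs
      have e3 := polarKernel_anti hα hs.1 hs.2.le hR1
      have e4 := polarKernel_nonneg (α := α) hR1 hR0
      have e5 := logKernel_nonneg (α := α) hs.1 hs.2.le hR1
      have e6 : s ^ 2 * logKernel α R s ≤ s * logKernel α R s := by
        have : s ^ 2 ≤ s := by nlinarith [hs.1, hs.2]
        exact mul_le_mul_of_nonneg_right this e5
      have e7 := mul_nonneg hα e5
      rw [norm_mul, norm_mul, Complex.norm_real, ← mul_assoc]
      gcongr
      rw [norm_pow, Complex.norm_real, Real.norm_eq_abs, Real.norm_eq_abs, sq_abs]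
      have : |polarKernel α s - polarKernel α R - α * logKernel α R s|
          ≤ polarKernel α s + α * logKernel α R s := by
        rw [abs_le]
        constructor <;> linarith
      have e8 := mul_le_mul_of_nonneg_right this (sq_nonneg s)
      have e9 : α * (s ^ 2 * logKernel α R s) ≤ α * 1 :=
        mul_le_mul_of_nonneg_left (e6.trans e2) hα
      nlinarith
    · simpa using h2.norm.const_mul (1 + α)
  have hB : Tendsto (fun s : ℝ => (logKernel α R s : ℂ) * (s * mode 1 F s)) (𝓝[>] 0) (𝓝 0) := by
    refine squeeze_zero_norm' (a := fun s : ℝ => ‖mode 1 F s‖) ?_ ?_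
    · filter_upwards [hmem] with s hs
      have e2 := hlog s hs
      have e5 := logKernel_nonneg (α := α) hs.1 hs.2.le hR1
      rw [norm_mul, norm_mul, Complex.norm_real, Complex.norm_real, ← mul_assoc,
        Real.norm_of_nonneg e5, Real.norm_of_nonneg hs.1.le, mul_comm (logKernel α R s)]
      exact mul_le_of_le_one_left (norm_nonneg _) e2
    · simpa using h3.norm
  rw [show 2 * Real.pi * (p 0 + c * f 0)
    = 2 * Real.pi * p 0 + 0 + c * (2 * Real.pi * f 0 + 0) by ring]
  exact (h1.add hA).add ((h0.add hB).const_mul c)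

/-- The radial function whose value near `0` is a multiple of `∂f/∂z̄(0)`. -/
def radialDzbar (α R : ℝ) (f F : ℂ → ℂ) (s : ℝ) : ℂ :=
  (α + 1) * (s * mode (-1) f s)
    + (((1 - s ^ 2) ^ (α + 1) - (1 - R ^ 2) ^ (α + 1) : ℝ) : ℂ) * mode 0 F s

/-- The derivative of `(1 - s²)^(α+1)` is `-2 (α + 1) s (1 - s²)^α`, which explains the factor `α +
1` in front of `s * mode (-1) f`: the `mode 0 F` terms cancel. -/
theorem hasDerivAt_radialDzbar (h : WeightedSystem α f p F g q) (hs0 : 0 < s) (hs1 : s < 1) :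
    HasDerivAt (radialDzbar α R f F)
      (2 * (((1 - s ^ 2) ^ (α + 1) - (1 - R ^ 2) ^ (α + 1) : ℝ) : ℂ) * mode (-1) g s) s := by
  have h1 := hasDerivAt_zpow_neg_mul_mode (-1) h.continuousOn_p h.continuousOn_dzbar h.deriv_left
    hs0 hs1
  have h2 := hasDerivAt_zpow_mul_mode 0 h.continuousOn_g h.continuousOn_q h.deriv_right hs0 hs1
  have hB := (hasDerivAt_one_sub_sq_rpow hs0 hs1 α).sub_const ((1 - R ^ 2) ^ (α + 1))
  have key := (h1.const_mul ((α : ℂ) + 1)).add (hB.ofReal_comp.mul h2)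
  simp only [neg_neg, zpow_one, zpow_zero, one_mul, mode_weight, mul_one] at key
  norm_num at key
  refine (key.congr_deriv ?_).congr_of_eventuallyEq (Eventually.of_forall fun r => ?_)
  · push_cast
    ring
  · simp [radialDzbar]

theorem tendsto_radialDzbar (h : WeightedSystem α f p F g q) :
    Tendsto (radialDzbar α R f F) (𝓝[>] 0)
      (𝓝 (2 * Real.pi * ((1 - (1 - R ^ 2) ^ (α + 1) : ℝ) * F 0))) := by
  have h1 := tendsto_mode_zero (-1) h.continuousOn_f
  have h0 := tendsto_mode_zero 0 h.continuousOn_F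
  rw [mode_zero_eq] at h0
  have hs : Tendsto (fun s : ℝ => (s : ℂ)) (𝓝[>] 0) (𝓝 ((0 : ℝ) : ℂ)) :=
    (Complex.continuous_ofReal.tendsto 0).mono_left nhdsWithin_le_nhds
  have hc : ContinuousAt (fun s : ℝ => (1 - s ^ 2) ^ (α + 1) - (1 - R ^ 2) ^ (α + 1)) 0 :=
    (ContinuousAt.rpow_const (by fun_prop) (Or.inl (by norm_num))).sub continuousAt_const
  have hB := (Complex.continuous_ofReal.tendsto _).comp
    (hc.tendsto.mono_left (nhdsWithin_le_nhds (s := Ioi 0)))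
  rw [show 2 * Real.pi * ((1 - (1 - R ^ 2) ^ (α + 1) : ℝ) * F 0)
    = ((α : ℂ) + 1) * (((0 : ℝ) : ℂ) * mode (-1) f 0)
      + (((1 - 0 ^ 2) ^ (α + 1) - (1 - R ^ 2) ^ (α + 1) : ℝ) : ℂ) * (2 * Real.pi * F 0) by
    simp
    ring]
  exact ((hs.mul h1).const_mul ((α : ℂ) + 1)).add (hB.mul h0)

end WeightedSystem

/-! ### Circle means of powers of `|1 + b e^{it}|` -/

section CircleIntegrals

variable {b : ℂ}

theorem one_add_mul_ne_zero (hb : ‖b‖ < 1) {z : ℂ} (hz : ‖z‖ ≤ 1) : 1 + b * z ≠ 0 := fun h => by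
  have h1 : ‖b * z‖ < 1 := by
    rw [norm_mul]
    nlinarith [norm_nonneg b, norm_nonneg z]
  rw [show b * z = -1 by linear_combination h, norm_neg, norm_one] at h1
  exact lt_irrefl _ h1

/-- The holomorphic function whose real part is the Poisson kernel. -/
def herglotz (b z : ℂ) : ℂ := (1 - b * z) / (1 + b * z)

/-- The mean value property of a holomorphic function equal to `1` at the centre. -/
theorem integral_herglotz_pow (hb : ‖b‖ < 1) (n : ℕ) :
    ∫ t in (0 : ℝ)..(2 * Real.pi), herglotz b (cis t) ^ n = 2 * Real.pi := by
  have hd : DifferentiableOn ℂ (fun z => herglotz b z ^ n) (Metric.closedBall 0 1) := fun z hz => by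
    have h0 := one_add_mul_ne_zero hb (mem_closedBall_zero_iff.1 hz)
    have h1 : HasDerivAt (fun z => b * z) b z := by simpa using (hasDerivAt_id' z).const_mul b
    exact (((h1.const_sub 1).div (h1.const_add 1) h0).differentiableAt.pow
      n).differentiableWithinAt
  have hd' : DiffContOnCl ℂ (fun z => herglotz b z ^ n) (Metric.ball 0 |1|) := by
    rw [abs_one]
    exact hd.diffContOnCl_ball subset_rfl
  have h := hd'.circleAverage
  have h0 : herglotz b 0 = 1 := by simp [herglotz]
  rw [Real.circleAverage_def, h0, one_pow] at h
  have hpi : (2 * Real.pi : ℝ) ≠ 0 := by positivity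
  have h1 := congrArg (fun x => (2 * Real.pi) • x) h
  simp only [smul_smul, mul_inv_cancel₀ hpi, one_smul] at h1
  simpa [circleMap, cis] using h1

theorem continuous_herglotz_cis (hb : ‖b‖ < 1) : Continuous fun t => herglotz b (cis t) := by
  unfold herglotz
  exact Continuous.div (by fun_prop) (by fun_prop) fun t =>
    one_add_mul_ne_zero hb (norm_cis t).le

theorem integral_re_herglotz_pow (hb : ‖b‖ < 1) (n : ℕ) :
    ∫ t in (0 : ℝ)..(2 * Real.pi), (herglotz b (cis t) ^ n).re = 2 * Real.pi := by
  have h := Complex.reCLM.intervalIntegral_comp_comm (μ := MeasureTheory.volume)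
    (((continuous_herglotz_cis hb).pow n).intervalIntegrable 0 (2 * Real.pi))
  simp only [Complex.reCLM_apply, Pi.pow_apply] at h
  rw [h, integral_herglotz_pow hb n]
  simp

theorem re_herglotz (b : ℂ) (t : ℝ) :
    (herglotz b (cis t)).re = (1 - ‖b‖ ^ 2) / ‖1 + b * cis t‖ ^ 2 := by
  have hw : ‖b‖ ^ 2 = ‖b * cis t‖ ^ 2 := by rw [norm_mul, norm_cis, mul_one]
  rw [hw, herglotz]
  generalize b * cis t = w
  rw [Complex.div_re, ← add_div, ← Complex.normSq_eq_norm_sq (1 + w), ← Complex.normSq_eq_norm_sq w]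
  congr 1
  simp [Complex.normSq_apply]
  ring

theorem norm_one_add_inv_sq_eq (hb : ‖b‖ < 1) (t : ℝ) :
    (‖1 + b * cis t‖ ^ 2)⁻¹ = (1 - ‖b‖ ^ 2)⁻¹ * (herglotz b (cis t) ^ 1).re := by
  have hne : ‖1 + b * cis t‖ ≠ 0 := norm_ne_zero_iff.2 (one_add_mul_ne_zero hb (norm_cis t).le)
  have hb2 : 1 - ‖b‖ ^ 2 ≠ 0 := by nlinarith [norm_nonneg b]
  rw [pow_one, re_herglotz]
  field_simp

theorem integral_norm_one_add_inv_sq (hb : ‖b‖ < 1) :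
    ∫ t in (0 : ℝ)..(2 * Real.pi), (‖1 + b * cis t‖ ^ 2)⁻¹ = 2 * Real.pi / (1 - ‖b‖ ^ 2) := by
  simp only [norm_one_add_inv_sq_eq hb]
  rw [intervalIntegral.integral_const_mul, integral_re_herglotz_pow hb 1]
  ring

/-- Let `H` be the Herglotz function. Then `Re H² = 2 (Re H)² - |H|²`, where `(Re H)²` is a multiple
of `|1 + w|⁻⁴` and, by the parallelogram law, `|H|²` is affine in `|1 + w|⁻²`. Solving for the
fourth power leaves terms with known means. -/
theorem norm_one_add_inv_pow_four_eq (hb : ‖b‖ < 1) (t : ℝ) :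
    (‖1 + b * cis t‖ ^ 4)⁻¹ = ((1 - ‖b‖ ^ 2) ^ 2)⁻¹ *
      ((1 + ‖b‖ ^ 2) * (‖1 + b * cis t‖ ^ 2)⁻¹ - 1 / 2 + (herglotz b (cis t) ^ 2).re / 2) := by
  have hne : ‖1 + b * cis t‖ ≠ 0 := norm_ne_zero_iff.2 (one_add_mul_ne_zero hb (norm_cis t).le)
  have hb2 : 1 - ‖b‖ ^ 2 ≠ 0 := by nlinarith [norm_nonneg b]
  have h1 : (herglotz b (cis t) ^ 2).re
      = 2 * (herglotz b (cis t)).re ^ 2 - ‖herglotz b (cis t)‖ ^ 2 := by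
    rw [← Complex.normSq_eq_norm_sq, Complex.normSq_apply, sq, Complex.mul_re]
    ring
  have h2 : ‖1 - b * cis t‖ ^ 2 = 2 * (1 + ‖b‖ ^ 2) - ‖1 + b * cis t‖ ^ 2 := by
    have := parallelogram_law_with_norm ℝ (1 : ℂ) (b * cis t)
    rw [norm_one, norm_mul, norm_cis, mul_one] at this
    linear_combination this
  rw [h1, re_herglotz, herglotz, norm_div, div_pow, div_pow, h2]
  field_simp
  ring

theorem integral_norm_one_add_inv_pow_four (hb : ‖b‖ < 1) :
    ∫ t in (0 : ℝ)..(2 * Real.pi), (‖1 + b * cis t‖ ^ 4)⁻¹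
      = 2 * Real.pi * (1 + ‖b‖ ^ 2) / (1 - ‖b‖ ^ 2) ^ 3 := by
  have hb2 : 1 - ‖b‖ ^ 2 ≠ 0 := by nlinarith [norm_nonneg b]
  have c1 : Continuous fun t => (1 + ‖b‖ ^ 2) * (‖1 + b * cis t‖ ^ 2)⁻¹ := by
    refine continuous_const.mul (Continuous.inv₀ (by fun_prop) fun t => ?_)
    exact pow_ne_zero 2 (norm_ne_zero_iff.2 (one_add_mul_ne_zero hb (norm_cis t).le))
  have c2 : Continuous fun t => (herglotz b (cis t) ^ 2).re / 2 :=
    (Complex.continuous_re.comp ((continuous_herglotz_cis hb).pow 2)).div_const 2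
  simp only [norm_one_add_inv_pow_four_eq hb]
  rw [intervalIntegral.integral_const_mul, intervalIntegral.integral_add
    (f := fun t => (1 + ‖b‖ ^ 2) * (‖1 + b * cis t‖ ^ 2)⁻¹ - 1 / 2)
    ((c1.sub continuous_const).intervalIntegrable _ _) (c2.intervalIntegrable _ _),
    intervalIntegral.integral_sub (c1.intervalIntegrable _ _) intervalIntegrable_const,
    intervalIntegral.integral_const_mul, intervalIntegral.integral_div 2 (fun t => (herglotz b (cis t) ^ 2).re),
    integral_norm_one_add_inv_sq hb, integral_re_herglotz_pow hb 2]
  simp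
  field_simp
  ring

end CircleIntegrals

/-! ### Majorants for the source term -/

section Majorant

/-- An antiderivative dominating `2 (1 - s²)` times the mean of `|1 + ā s e^{it}|⁻⁴`. -/
def majorant (ρ s : ℝ) : ℝ :=
  (2 * (1 - s ^ 2) * s + 4 / 3 * (1 - ρ) * s ^ 3) / (1 - ρ * s ^ 2) ^ 2

/-- The derivative of `majorant`. -/
def majorantDeriv (ρ s : ℝ) : ℝ :=
  2 * (1 - s ^ 2) * (1 + ρ * s ^ 2) / (1 - ρ * s ^ 2) ^ 3
    + 4 / 3 * (1 - ρ) * ρ * s ^ 4 / (1 - ρ * s ^ 2) ^ 3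

variable {ρ s : ℝ}

/-- The first summand of `majorantDeriv` is what has to be integrated. Its exact antiderivative
contains a logarithm when `ρ > 0`; the cubic term of `majorant` avoids it, at the price of the
second, nonnegative summand. -/
theorem hasDerivAt_majorant (h : 1 - ρ * s ^ 2 ≠ 0) :
    HasDerivAt (majorant ρ) (majorantDeriv ρ s) s := by
  have h2 : HasDerivAt (fun s : ℝ => s ^ 2) (2 * s) s := by simpa using hasDerivAt_pow 2 s
  have h3 : HasDerivAt (fun s : ℝ => s ^ 3) (3 * s ^ 2) s := by simpa using hasDerivAt_pow 3 s
  have key := ((((h2.const_sub 1).const_mul 2).mul (hasDerivAt_id s)).add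
    (h3.const_mul (4 / 3 * (1 - ρ)))).div (((h2.const_mul ρ).const_sub 1).pow 2) (pow_ne_zero 2 h)
  refine key.congr_deriv ?_
  simp [majorantDeriv]
  field_simp
  ring

@[simp] theorem majorant_zero (ρ : ℝ) : majorant ρ 0 = 0 := by simp [majorant]

theorem majorant_one (h : ρ < 1) : majorant ρ 1 = 4 / 3 / (1 - ρ) := by
  have : 1 - ρ ≠ 0 := by linarith
  simp [majorant]
  field_simp

end Majorant

/-! ### Pointwise bounds after the change of variables -/

section Bounds

variable {a z : ℂ} {α : ℝ}

theorem norm_mobiusDeriv (ha : a ∈ disc) (z : ℂ) :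
    ‖mobiusDeriv a z‖ = (1 - ‖a‖ ^ 2) / ‖mobiusDen a z‖ ^ 2 := by
  rw [mobiusDeriv, norm_div, norm_pow, Complex.norm_real,
    Real.norm_of_nonneg (one_sub_normSq_pos ha).le]

theorem norm_mobiusFactor (ha : a ∈ disc) (z : ℂ) :
    ‖mobiusFactor α a z‖
      = (1 - ‖a‖ ^ 2) ^ α * ‖mobiusDen a z‖ ^ (-α) * ‖mobiusDeriv a z‖ := by
  rw [mobiusFactor, norm_mul, norm_mul, Complex.norm_real, ← Complex.ofReal_neg,
    Complex.norm_cpow_real,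
    Real.norm_of_nonneg (Real.rpow_nonneg (one_sub_normSq_pos ha).le _)]

/-- From `(1 - |z|²)(1 - |a|²) ≤ |1 + ā z|² ≤ 2 |1 + ā z|`, raised to the power `α`; the power of
`|1 + ā z|` left over cancels the one in `mobiusFactor`. -/
theorem mobius_weight_le (hα : 0 ≤ α) (ha : a ∈ disc) (hz : z ∈ disc) :
    (1 - ‖z‖ ^ 2) ^ (α + 1) * (‖mobiusDeriv a z‖ * ‖mobiusFactor α a z‖)
      ≤ 2 ^ α * (1 - ‖a‖ ^ 2) ^ 2 * (1 - ‖z‖ ^ 2) * (‖mobiusDen a z‖ ^ 4)⁻¹ := by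
  have hx := norm_mobiusDen_pos ha hz
  have hz1 := one_sub_normSq_pos hz
  have ha1 := one_sub_normSq_pos ha
  have h1 : (1 - ‖z‖ ^ 2) ^ α * (1 - ‖a‖ ^ 2) ^ α ≤ 2 ^ α * ‖mobiusDen a z‖ ^ α := by
    rw [← Real.mul_rpow hz1.le ha1.le, ← Real.mul_rpow (by norm_num) hx.le]
    refine Real.rpow_le_rpow (by positivity) ((mul_le_normSq_mobiusDen a z).trans ?_) hα
    rw [sq]
    exact mul_le_mul_of_nonneg_right (norm_mobiusDen_le ha hz) hx.le
  rw [norm_mobiusFactor ha, norm_mobiusDeriv ha, Real.rpow_add_one hz1.ne', Real.rpow_neg hx.le]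
  have hxα : 0 < ‖mobiusDen a z‖ ^ α := Real.rpow_pos_of_pos hx α
  calc _ = ((1 - ‖z‖ ^ 2) ^ α * (1 - ‖a‖ ^ 2) ^ α) * ((‖mobiusDen a z‖ ^ α)⁻¹
        * ((1 - ‖a‖ ^ 2) ^ 2 * (1 - ‖z‖ ^ 2) * (‖mobiusDen a z‖ ^ 4)⁻¹)) := by
        field_simp
    _ ≤ (2 ^ α * ‖mobiusDen a z‖ ^ α) * ((‖mobiusDen a z‖ ^ α)⁻¹
        * ((1 - ‖a‖ ^ 2) ^ 2 * (1 - ‖z‖ ^ 2) * (‖mobiusDen a z‖ ^ 4)⁻¹)) :=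
        mul_le_mul_of_nonneg_right h1 (by positivity)
    _ = _ := by field_simp

/-- The majorant of the contribution of the right-hand side. -/
def sourceMajorant (α β K ρ s : ℝ) : ℝ :=
  2 * Real.pi * (K * 2 ^ α * (1 - ρ) ^ 2)
    * ((1 + β / 2) * majorant ρ s + β / 2 * ((2 * s - 2 / 3 * s ^ 3) / (1 - ρ)))

/-- The derivative of `sourceMajorant`. -/
def sourceMajorantDeriv (α β K ρ s : ℝ) : ℝ :=
  2 * Real.pi * (K * 2 ^ α * (1 - ρ) ^ 2)
    * ((1 + β / 2) * majorantDeriv ρ s + β / 2 * (2 * (1 - s ^ 2) / (1 - ρ)))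

theorem hasDerivAt_sourceMajorant (α β K : ℝ) {ρ s : ℝ} (h : 1 - ρ * s ^ 2 ≠ 0) :
    HasDerivAt (sourceMajorant α β K ρ) (sourceMajorantDeriv α β K ρ s) s := by
  have h3 : HasDerivAt (fun s : ℝ => s ^ 3) (3 * s ^ 2) s := by simpa using hasDerivAt_pow 3 s
  have h1 := ((((hasDerivAt_id' s).const_mul 2).sub (h3.const_mul (2 / 3))).div_const
    (1 - ρ)).const_mul (β / 2)
  refine ((((hasDerivAt_majorant h).const_mul (1 + β / 2)).add h1).const_mul
    (2 * Real.pi * (K * 2 ^ α * (1 - ρ) ^ 2))).congr_deriv ?_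
  rw [sourceMajorantDeriv]
  ring

@[simp] theorem sourceMajorant_zero (α β K ρ : ℝ) : sourceMajorant α β K ρ 0 = 0 := by
  simp [sourceMajorant]

theorem sourceMajorant_one (α β K : ℝ) {ρ : ℝ} (h : ρ < 1) :
    sourceMajorant α β K ρ 1 = 2 * Real.pi * (K * 2 ^ α * (1 - ρ) * (4 / 3 * (1 + β))) := by
  have : 1 - ρ ≠ 0 := by linarith
  rw [sourceMajorant, majorant_one h]
  field_simp
  ring

/-- Serves both derivatives: `β = α` for `∂/∂z` and `β = 0` for `∂/∂z̄`. -/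
theorem norm_integral_source_le {β K s : ℝ} {g : ℂ → ℂ} {W : ℝ → ℂ} (hα : 0 ≤ α) (hβ : 0 ≤ β)
    (ha : a ∈ disc) (hg : ∀ z ∈ disc, ‖g z‖ ≤ K) (hs0 : 0 ≤ s) (hs1 : s < 1)
    (hW : ∀ t, ‖W t‖ ≤ 2 * (1 - s ^ 2) ^ (α + 1) * (1 + β * ‖mobiusDen a (s * cis t)‖)) :
    ‖∫ t in (0 : ℝ)..(2 * Real.pi), W t * (g (mobius a (s * cis t)) * mobiusDeriv a (s * cis t)
      * conj (mobiusFactor α a (s * cis t)))‖ ≤ sourceMajorantDeriv α β K (‖a‖ ^ 2) s := by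
  have hK : 0 ≤ K := (norm_nonneg _).trans (hg a ha)
  have ha1 := one_sub_normSq_pos ha
  have hsd : (s : ℂ) ∈ disc := ofReal_mem_disc (by linarith) hs1
  have hs2 : 0 < 1 - s ^ 2 := by nlinarith
  set b : ℂ := conj a * s with hb_def
  have hb : ‖b‖ < 1 := norm_mul_lt_one ha hsd
  have hb2 : ‖b‖ ^ 2 = ‖a‖ ^ 2 * s ^ 2 := by
    rw [hb_def, norm_mul, RCLike.norm_conj, mul_pow, Complex.norm_real, Real.norm_eq_abs, sq_abs]
  have hden : ∀ t, mobiusDen a (s * cis t) = 1 + b * cis t := fun t => by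
    rw [mobiusDen, hb_def, mul_assoc]
  have hpos : ∀ t, 0 < ‖1 + b * cis t‖ := fun t =>
    norm_pos_iff.2 (one_add_mul_ne_zero hb (norm_cis t).le)
  have hnorm : ∀ t, ‖(s : ℂ) * cis t‖ = s := fun t => by
    rw [norm_mul, norm_cis, mul_one, Complex.norm_real, Real.norm_of_nonneg hs0]
  have c4 : Continuous fun t => (‖1 + b * cis t‖ ^ 4)⁻¹ :=
    Continuous.inv₀ (by fun_prop) fun t => pow_ne_zero 4 (hpos t).ne'
  have c2 : Continuous fun t => (‖1 + b * cis t‖ ^ 2)⁻¹ :=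
    Continuous.inv₀ (by fun_prop) fun t => pow_ne_zero 2 (hpos t).ne'
  set C := K * 2 ^ α * (1 - ‖a‖ ^ 2) ^ 2 * (2 * (1 - s ^ 2)) with hC
  have hC0 : 0 ≤ C := by positivity
  have hpt : ∀ t, ‖W t * (g (mobius a (s * cis t)) * mobiusDeriv a (s * cis t)
      * conj (mobiusFactor α a (s * cis t)))‖
      ≤ C * ((1 + β / 2) * (‖1 + b * cis t‖ ^ 4)⁻¹ + β / 2 * (‖1 + b * cis t‖ ^ 2)⁻¹) := fun t => by
    have hzd := mul_cis_mem_disc hsd t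
    have h1 := mobius_weight_le hα ha hzd
    have h2 := hg _ (mobius_mem_disc ha hzd)
    have h3 := hW t
    rw [hnorm, hden] at h1
    rw [hden] at h3
    rw [norm_mul, norm_mul, norm_mul, RCLike.norm_conj]
    have hD : 0 ≤ ‖mobiusDeriv a (s * cis t)‖ := norm_nonneg _
    generalize ‖mobiusDeriv a (s * cis t)‖ = D at *
    have hx := hpos t
    generalize ‖1 + b * cis t‖ = x at *
    calc ‖W t‖ * (‖g (mobius a (s * cis t))‖ * D * ‖mobiusFactor α a (s * cis t)‖)
        = ‖W t‖ * ‖g (mobius a (s * cis t))‖ * (D * ‖mobiusFactor α a (s * cis t)‖) := by ring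
      _ ≤ 2 * (1 - s ^ 2) ^ (α + 1) * (1 + β * x) * K
          * (D * ‖mobiusFactor α a (s * cis t)‖) := by gcongr
      _ = 2 * K * (1 + β * x) * ((1 - s ^ 2) ^ (α + 1)
          * (D * ‖mobiusFactor α a (s * cis t)‖)) := by ring
      _ ≤ 2 * K * (1 + β * x) * (2 ^ α * (1 - ‖a‖ ^ 2) ^ 2 * (1 - s ^ 2) * (x ^ 4)⁻¹) := by gcongr
      _ = C * ((1 + β * x) * (x ^ 4)⁻¹) := by rw [hC]; ring
      -- By the arithmetic-geometric mean inequality `x⁻³ ≤ (x⁻⁴ + x⁻²) / 2`; only the even powers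
      -- have the closed-form means computed above.
      _ ≤ _ := by
        refine mul_le_mul_of_nonneg_left ?_ hC0
        have : (1 + β / 2) * (x ^ 4)⁻¹ + β / 2 * (x ^ 2)⁻¹ - (1 + β * x) * (x ^ 4)⁻¹
            = β / 2 * (1 - x) ^ 2 * (x ^ 4)⁻¹ := by
          field_simp
          ring
        have h5 : 0 ≤ β / 2 * (1 - x) ^ 2 * (x ^ 4)⁻¹ := by positivity
        linarith
  have hint := intervalIntegral.norm_integral_le_of_norm_le (μ := MeasureTheory.volume)
    (by positivity : (0 : ℝ) ≤ 2 * Real.pi) (Eventually.of_forall fun t _ => hpt t)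
    ((by fun_prop : Continuous fun t => C * ((1 + β / 2) * (‖1 + b * cis t‖ ^ 4)⁻¹
      + β / 2 * (‖1 + b * cis t‖ ^ 2)⁻¹)).intervalIntegrable _ _)
  refine hint.trans ?_
  rw [intervalIntegral.integral_const_mul, intervalIntegral.integral_add
    ((c4.const_mul _).intervalIntegrable _ _) ((c2.const_mul _).intervalIntegrable _ _),
    intervalIntegral.integral_const_mul, intervalIntegral.integral_const_mul,
    integral_norm_one_add_inv_sq hb, integral_norm_one_add_inv_pow_four hb, hb2]
  have hq : 1 - ‖a‖ ^ 2 ≤ 1 - ‖a‖ ^ 2 * s ^ 2 := by nlinarith [sq_nonneg ‖a‖]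
  have hq0 : 0 < 1 - ‖a‖ ^ 2 * s ^ 2 := ha1.trans_le hq
  have e1 : 2 * (1 - s ^ 2) * (1 + ‖a‖ ^ 2 * s ^ 2) / (1 - ‖a‖ ^ 2 * s ^ 2) ^ 3
      ≤ majorantDeriv (‖a‖ ^ 2) s := by
    rw [majorantDeriv]
    have : 0 ≤ 4 / 3 * (1 - ‖a‖ ^ 2) * ‖a‖ ^ 2 * s ^ 4 / (1 - ‖a‖ ^ 2 * s ^ 2) ^ 3 := by positivity
    linarith
  -- Freezing the denominator at `s = 1` makes the antiderivative of this term a polynomial.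
  have e2 : 2 * (1 - s ^ 2) / (1 - ‖a‖ ^ 2 * s ^ 2) ≤ 2 * (1 - s ^ 2) / (1 - ‖a‖ ^ 2) :=
    div_le_div_of_nonneg_left (by positivity) ha1 hq
  calc _ = 2 * Real.pi * (K * 2 ^ α * (1 - ‖a‖ ^ 2) ^ 2)
        * ((1 + β / 2) * (2 * (1 - s ^ 2) * (1 + ‖a‖ ^ 2 * s ^ 2) / (1 - ‖a‖ ^ 2 * s ^ 2) ^ 3)
          + β / 2 * (2 * (1 - s ^ 2) / (1 - ‖a‖ ^ 2 * s ^ 2))) := by rw [hC]; ring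
    _ ≤ _ := by
      rw [sourceMajorantDeriv]
      gcongr

/-- On `|z| = R`, `1 - |φ_a(z)|²` is at most `(1 - R²)(1 - |a|²) / (1 - |a|)²`, which tends to `0`.
A bound on `f` in a thin annulus thus controls the composition on circles close to the boundary. -/
theorem eventually_lt_norm_mobius (ha : a ∈ disc) {r : ℝ} (hr : r < 1) :
    ∀ᶠ R : ℝ in 𝓝[<] 1, ∀ z, ‖z‖ = R → r < ‖mobius a z‖ := by
  have ha' : 0 < 1 - ‖a‖ := by linarith [mem_disc.1 ha]
  have ha1 := one_sub_normSq_pos ha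
  set r' := max r 0
  have hr' : r' < 1 := max_lt hr one_pos
  have hr0 : 0 ≤ r' := le_max_right _ _
  have ht : Tendsto (fun R : ℝ => (1 - R ^ 2) * (1 - ‖a‖ ^ 2) / (1 - ‖a‖) ^ 2) (𝓝[<] 1) (𝓝 0) := by
    have : ContinuousAt (fun R : ℝ => (1 - R ^ 2) * (1 - ‖a‖ ^ 2) / (1 - ‖a‖) ^ 2) 1 := by fun_prop
    have h2 := this.tendsto.mono_left (nhdsWithin_le_nhds (s := Iio 1))
    simpa using h2
  have h1 := ht.eventually_lt_const (show 0 < 1 - r' ^ 2 by nlinarith)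
  filter_upwards [h1, Ioo_mem_nhdsLT (show (0 : ℝ) < 1 by norm_num)] with R hR hR1 z hz
  have hzd : z ∈ disc := by rw [mem_disc, hz]; exact hR1.2
  have h2 := one_sub_normSq_mobius ha hzd
  have h3 : (1 - ‖z‖ ^ 2) * (1 - ‖a‖ ^ 2) / ‖mobiusDen a z‖ ^ 2
      ≤ (1 - R ^ 2) * (1 - ‖a‖ ^ 2) / (1 - ‖a‖) ^ 2 := by
    rw [hz]
    have := one_sub_norm_le_norm_mobiusDen (a := a) hzd
    have h4 : 0 < 1 - R ^ 2 := by nlinarith [hR1.1, hR1.2]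
    gcongr
  refine (le_max_left r 0).trans_lt ?_
  have h5 : r' ^ 2 < ‖mobius a z‖ ^ 2 := by linarith
  exact lt_of_pow_lt_pow_left₀ 2 (norm_nonneg _) h5

theorem norm_weighted_comp_le (hα : 0 ≤ α) (ha : a ∈ disc) (hz : z ∈ disc) {f : ℂ → ℂ} {B : ℝ}
    (hB : ‖f (mobius a z)‖ ≤ B) :
    ‖mobiusDen a z ^ (α : ℂ) * f (mobius a z)‖ ≤ 2 ^ α * B := by
  rw [norm_mul, Complex.norm_cpow_real]
  have := norm_mobiusDen_le ha hz
  gcongr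

end Bounds

theorem mode_combination {u : ℂ → ℂ} (hu : ContinuousOn u disc) {z : ℂ} (hz : z ∈ disc) (x y : ℂ) :
    x * mode 1 u z + y * mode 0 u z
      = ∫ t in (0 : ℝ)..(2 * Real.pi), (x * cis (-t) + y) * u (z * cis t) := by
  have h1 := (continuous_mul_comp_cis (continuous_cis_zpow (-1)) hu hz).const_mul x
  have h0 := (continuous_mul_comp_cis (continuous_cis_zpow (-0)) hu hz).const_mul y
  simp only [mode, avg]
  rw [← intervalIntegral.integral_const_mul, ← intervalIntegral.integral_const_mul,
    ← intervalIntegral.integral_add (h1.intervalIntegrable _ _) (h0.intervalIntegrable _ _)]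
  congr 1
  ext t
  rw [zpow_neg_one, neg_zero, zpow_zero, Complex.inv_eq_conj (norm_cis t), conj_cis]
  ring

theorem norm_integral_circle_le {w : ℝ → ℂ} {C : ℝ} (h : ∀ t, ‖w t‖ ≤ C) :
    ‖∫ t in (0 : ℝ)..(2 * Real.pi), w t‖ ≤ 2 * Real.pi * C := by
  have := intervalIntegral.norm_integral_le_of_norm_le_const (a := 0) (b := 2 * Real.pi)
    (f := w) (C := C) fun t _ => h t
  rwa [sub_zero, abs_of_nonneg (by positivity), mul_comm C] at this

theorem tendsto_sourceMajorant (α β K : ℝ) {ρ : ℝ} (h : ρ < 1) :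
    Tendsto (sourceMajorant α β K ρ) (𝓝[<] 1)
      (𝓝 (2 * Real.pi * (K * 2 ^ α * (1 - ρ) * (4 / 3 * (1 + β))))) := by
  rw [← sourceMajorant_one α β K h]
  refine (hasDerivAt_sourceMajorant α β K ?_).continuousAt.tendsto.mono_left nhdsWithin_le_nhds
  nlinarith

/-! ### Estimates of both Wirtinger derivatives from a bound near the boundary -/

namespace WeightedSystem

variable {α : ℝ} {f p F g q : ℂ → ℂ} {K : ℝ} {a : ℂ}

/-- The choice `c = -α ā` cancels the derivative of `(1 + ā z)^α` at the origin, so the limit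
contains `p a` alone. -/
theorem norm_radialDz_sub_le (h : WeightedSystem α f p F g q) (hα : 0 ≤ α) (ha : a ∈ disc)
    (hg : ∀ z ∈ disc, ‖g z‖ ≤ K) {R : ℝ} (hR0 : 0 < R) (hR1 : R < 1) :
    ‖radialDz α R (-(α * conj a)) (fun z => mobiusDen a z ^ (α : ℂ) * f (mobius a z))
        (fun z => F (mobius a z) * conj (mobiusFactor α a z)) R
      - 2 * Real.pi * ((1 - ‖a‖ ^ 2 : ℝ) * p a)‖ ≤ sourceMajorant α α K (‖a‖ ^ 2) R := by
  have hv := h.comp_mobius ha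
  have hlim := hv.tendsto_radialDz hα (-(α * conj a)) hR0 hR1
  have ha1 := one_sub_normSq_pos ha
  have h0 : mobiusDen a 0 = 1 := by simp [mobiusDen]
  have h1 : mobius a 0 = a := by simp [mobius, h0]
  have key := norm_sub_le_of_tendsto_zero (N := sourceMajorant α α K (‖a‖ ^ 2))
    (N' := sourceMajorantDeriv α α K (‖a‖ ^ 2)) hR0
    (fun s hs => hv.hasDerivAt_radialDz (-(α * conj a)) hs.1 (hs.2.trans_lt hR1) hR0 hR1)
    (fun s hs => hasDerivAt_sourceMajorant α α K
      (by nlinarith [hs.1, hs.2, sq_nonneg ‖a‖, mul_le_mul hs.2 hs.2 hs.1 hR0.le])) ?_ hlim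
  · rw [sourceMajorant_zero, sub_zero] at key
    refine le_trans (le_of_eq ?_) key
    congr 2
    simp [h0, h1, mobiusDeriv, mul_comm]
  · intro s hs
    have hs0 := hs.1
    have hs1 := hs.2.trans_lt hR1
    have hsd : (s : ℂ) ∈ disc := ofReal_mem_disc (by linarith) hs1
    set A := polarKernel α s - polarKernel α R - α * logKernel α R s with hA
    -- Both modes of the source are put under one integral, since the bound needs a pointwise
    -- combination of their coefficients.
    rw [show ∀ x y : ℂ, 2 * (s : ℂ) * (s * (A : ℂ) * x + -(α * conj a) * logKernel α R s * y)
      = (2 * s * s * A) * x + (2 * s * -(α * conj a) * logKernel α R s) * y from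
      fun x y => by ring]
    rw [mode_combination hv.continuousOn_g hsd]
    refine norm_integral_source_le hα hα ha hg hs0.le hs1 fun t => ?_
    have hzd := mul_cis_mem_disc hsd t
    have e1 := polarKernel_anti hα hs.1 hs.2 hR1
    have e2 := polarKernel_nonneg (α := α) hR1 hR0
    have e3 := logKernel_nonneg (α := α) hs.1 hs.2 hR1
    have e4 := logKernel_le hα hs.1 hs.2 hR1
    have e5 := norm_conj_add_le_norm_mobiusDen ha hzd
    have e6 : conj ((s : ℂ) * cis t) = s * cis (-t) := by simp
    rw [e6] at e5
    -- The two logarithmic terms combine into the factor `z̄ + ā`, with `|z̄ + ā| ≤ |1 + ā z|`.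
    -- Together with `logKernel_le` this yields the factor `1 + α |1 + ā z|`.
    have e7 : 2 * s * s * A * cis (-t) + 2 * s * -(α * conj a) * logKernel α R s
        = 2 * s * (s * (polarKernel α s - polarKernel α R : ℝ) * cis (-t)
          - (α * logKernel α R s : ℝ) * (s * cis (-t) + conj a)) := by
      rw [hA]
      push_cast
      ring
    rw [e7, norm_mul]
    have e8 : ‖(2 * s : ℂ)‖ = 2 * s := by
      rw [norm_mul, Complex.norm_real, Real.norm_of_nonneg hs0.le]; simp
    have e9 : ‖(s : ℂ) * (polarKernel α s - polarKernel α R : ℝ) * cis (-t)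
          - (α * logKernel α R s : ℝ) * (s * cis (-t) + conj a)‖
        ≤ s * polarKernel α s * (1 + α * ‖mobiusDen a (s * cis t)‖) := by
      refine (norm_sub_le _ _).trans ?_
      rw [norm_mul, norm_mul, norm_mul, norm_cis, Complex.norm_real, Complex.norm_real,
        Complex.norm_real, Real.norm_of_nonneg hs0.le, Real.norm_of_nonneg (by linarith),
        Real.norm_of_nonneg (mul_nonneg hα e3), mul_one]
      have i1 : s * (polarKernel α s - polarKernel α R) ≤ s * polarKernel α s :=
        mul_le_mul_of_nonneg_left (by linarith) hs0.le
      have i0 : 0 ≤ α * (s * polarKernel α s) :=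
        mul_nonneg hα (mul_nonneg hs0.le (e2.trans e1))
      have i2 : α * logKernel α R s * ‖(s : ℂ) * cis (-t) + conj a‖
          ≤ α * (s * polarKernel α s) * ‖mobiusDen a (s * cis t)‖ := by gcongr
      linarith
    have e10 : s * (s * polarKernel α s) = (1 - s ^ 2) ^ (α + 1) := by
      rw [polarKernel]
      field_simp
    rw [e8, ← e10]
    calc _ ≤ 2 * s * (s * polarKernel α s * (1 + α * ‖mobiusDen a (s * cis t)‖)) := by gcongr
      _ = _ := by ring

theorem norm_radialDzbar_sub_le (h : WeightedSystem α f p F g q) (hα : 0 ≤ α) (ha : a ∈ disc)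
    (hg : ∀ z ∈ disc, ‖g z‖ ≤ K) {R : ℝ} (hR0 : 0 < R) (hR1 : R < 1) :
    ‖radialDzbar α R (fun z => mobiusDen a z ^ (α : ℂ) * f (mobius a z))
        (fun z => F (mobius a z) * conj (mobiusFactor α a z)) R
      - 2 * Real.pi * ((1 - (1 - R ^ 2) ^ (α + 1) : ℝ)
        * ((1 - ‖a‖ ^ 2 : ℝ) * (((1 - ‖a‖ ^ 2 : ℝ) ^ α : ℝ) * F a)))‖
      ≤ sourceMajorant α 0 K (‖a‖ ^ 2) R := by
  have hv := h.comp_mobius ha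
  have hlim := hv.tendsto_radialDzbar (R := R)
  have ha1 := one_sub_normSq_pos ha
  have h0 : mobiusDen a 0 = 1 := by simp [mobiusDen]
  have h1 : mobius a 0 = a := by simp [mobius, h0]
  have key := norm_sub_le_of_tendsto_zero (N := sourceMajorant α 0 K (‖a‖ ^ 2))
    (N' := sourceMajorantDeriv α 0 K (‖a‖ ^ 2)) hR0
    (fun s hs => hv.hasDerivAt_radialDzbar (R := R) hs.1 (hs.2.trans_lt hR1))
    (fun s hs => hasDerivAt_sourceMajorant α 0 K
      (by nlinarith [hs.1, hs.2, sq_nonneg ‖a‖, mul_le_mul hs.2 hs.2 hs.1 hR0.le])) ?_ hlim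
  · rw [sourceMajorant_zero, sub_zero] at key
    refine le_trans (le_of_eq ?_) key
    congr 2
    rw [h1, mobiusFactor, mobiusDeriv, h0, map_mul, map_mul, Complex.one_cpow, one_pow, div_one,
      map_one, Complex.conj_ofReal, Complex.conj_ofReal]
    ring
  · intro s hs
    have hs0 := hs.1
    have hs1 := hs.2.trans_lt hR1
    simp only [mode, avg]
    rw [← intervalIntegral.integral_const_mul]
    simp only [← mul_assoc]
    simp only [mul_assoc _ (g _), mul_assoc (_ * _ : ℂ) (g _ * _)]
    refine norm_integral_source_le hα le_rfl ha hg hs0.le hs1 fun t => ?_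
    have e1 : (1 - R ^ 2) ^ (α + 1) ≤ (1 - s ^ 2) ^ (α + 1) :=
      Real.rpow_le_rpow (one_sub_sq_pos hR0 hR1).le (by nlinarith [hs.2]) (by linarith)
    have e2 : 0 ≤ (1 - R ^ 2) ^ (α + 1) := Real.rpow_nonneg (one_sub_sq_pos hR0 hR1).le _
    rw [norm_mul, norm_mul, norm_zpow, norm_cis, one_zpow, Complex.norm_real,
      Real.norm_of_nonneg (by linarith)]
    simp
    linarith

theorem norm_dz_le_of_boundary (h : WeightedSystem α f p F g q) (hα : 0 ≤ α) (ha : a ∈ disc)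
    (hg : ∀ z ∈ disc, ‖g z‖ ≤ K) {B r : ℝ} (hr : r < 1)
    (hB : ∀ z ∈ disc, r < ‖z‖ → ‖f z‖ ≤ B) :
    (1 - ‖a‖ ^ 2) * ‖p a‖
      ≤ (α + 1) * 2 ^ α * B + K * 2 ^ α * (1 - ‖a‖ ^ 2) * (4 / 3 * (1 + α)) := by
  have hv := h.comp_mobius ha
  have ha1 := one_sub_normSq_pos ha
  have hπ := Real.pi_pos
  have hlim : Tendsto (fun R : ℝ => 2 * Real.pi * ((R⁻¹ + α) * (2 ^ α * B))
      + sourceMajorant α α K (‖a‖ ^ 2) R) (𝓝[<] 1)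
      (𝓝 (2 * Real.pi * ((1⁻¹ + α) * (2 ^ α * B))
        + 2 * Real.pi * (K * 2 ^ α * (1 - ‖a‖ ^ 2) * (4 / 3 * (1 + α))))) := by
    refine Tendsto.add ?_ (tendsto_sourceMajorant α α K (by linarith))
    have : ContinuousAt (fun R : ℝ => 2 * Real.pi * ((R⁻¹ + α) * (2 ^ α * B))) 1 := by
      fun_prop (disch := norm_num)
    exact this.tendsto.mono_left nhdsWithin_le_nhds
  have hle : 2 * Real.pi * ((1 - ‖a‖ ^ 2) * ‖p a‖) ≤ 2 * Real.pi * ((1⁻¹ + α) * (2 ^ α * B))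
        + 2 * Real.pi * (K * 2 ^ α * (1 - ‖a‖ ^ 2) * (4 / 3 * (1 + α))) := by
    refine ge_of_tendsto hlim ?_
    filter_upwards [eventually_lt_norm_mobius ha hr, Ioo_mem_nhdsLT (show (0 : ℝ) < 1 by norm_num)]
      with R hR hR1
    have hRd : (R : ℂ) ∈ disc := ofReal_mem_disc (by linarith [hR1.1]) hR1.2
    have key := h.norm_radialDz_sub_le hα ha hg hR1.1 hR1.2
    have hrad : ‖radialDz α R (-(α * conj a)) (fun z => mobiusDen a z ^ (α : ℂ) * f (mobius a z))
        (fun z => F (mobius a z) * conj (mobiusFactor α a z)) R‖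
        ≤ 2 * Real.pi * ((R⁻¹ + α) * (2 ^ α * B)) := by
      -- All kernels vanish at `s = R`, so no values of `F` enter.
      simp only [radialDz, logKernel_self, mul_zero, sub_self, Complex.ofReal_zero, zero_mul,
        add_zero]
      rw [mode_combination hv.continuousOn_f hRd]
      refine norm_integral_circle_le fun t => ?_
      have hzd := mul_cis_mem_disc hRd t
      have hn : ‖(R : ℂ) * cis t‖ = R := by
        rw [norm_mul, norm_cis, mul_one, Complex.norm_real, Real.norm_of_nonneg hR1.1.le]
      have h1 := norm_weighted_comp_le hα ha hzd (hB _ (mobius_mem_disc ha hzd) (hR _ hn))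
      rw [norm_mul]
      have h2 : ‖(R : ℂ)⁻¹ * cis (-t) + -(α * conj a)‖ ≤ R⁻¹ + α := by
        refine (norm_add_le _ _).trans ?_
        rw [norm_neg, norm_mul, norm_mul, norm_cis, RCLike.norm_conj, norm_inv, Complex.norm_real,
          Complex.norm_real, Real.norm_of_nonneg hR1.1.le, Real.norm_of_nonneg hα, mul_one]
        have := mul_le_of_le_one_right hα (mem_disc.1 ha).le
        linarith
      have h3 : 0 ≤ R⁻¹ + α := add_nonneg (inv_nonneg.2 hR1.1.le) hα
      exact mul_le_mul h2 h1 (norm_nonneg _) h3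
    have hnorm : ‖(2 * Real.pi * ((1 - ‖a‖ ^ 2 : ℝ) * p a) : ℂ)‖
        = 2 * Real.pi * ((1 - ‖a‖ ^ 2) * ‖p a‖) := by
      rw [norm_mul, norm_mul, norm_mul, Complex.norm_real, Complex.norm_real,
        Real.norm_of_nonneg hπ.le, Real.norm_of_nonneg ha1.le]
      simp
    rw [← hnorm]
    have := norm_le_norm_add_norm_sub' (2 * Real.pi * ((1 - ‖a‖ ^ 2 : ℝ) * p a) : ℂ)
      (radialDz α R (-(α * conj a)) (fun z => mobiusDen a z ^ (α : ℂ) * f (mobius a z))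
        (fun z => F (mobius a z) * conj (mobiusFactor α a z)) R)
    rw [norm_sub_rev] at this
    linarith
  have h2π : 0 < 2 * Real.pi := by positivity
  rw [← mul_add] at hle
  have := le_of_mul_le_mul_left hle h2π
  rw [inv_one] at this
  linarith

theorem norm_dzbar_le_of_boundary (h : WeightedSystem α f p F g q) (hα : 0 ≤ α) (ha : a ∈ disc)
    (hg : ∀ z ∈ disc, ‖g z‖ ≤ K) {B r : ℝ} (hr : r < 1)
    (hB : ∀ z ∈ disc, r < ‖z‖ → ‖f z‖ ≤ B) :
    (1 - ‖a‖ ^ 2) * ‖dzbar f a‖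
      ≤ (α + 1) * 2 ^ α * B + K * 2 ^ α * (1 - ‖a‖ ^ 2) * (4 / 3) := by
  have hv := h.comp_mobius ha
  have ha1 := one_sub_normSq_pos ha
  have hπ := Real.pi_pos
  rw [(h.deriv_left a ha).dzbar_eq]
  set y := (((1 - ‖a‖ ^ 2 : ℝ) ^ α : ℝ) : ℂ) * F a
  have hlim : Tendsto (fun R : ℝ => 2 * Real.pi * ((α + 1) * (2 ^ α * B))
      + sourceMajorant α 0 K (‖a‖ ^ 2) R) (𝓝[<] 1)
      (𝓝 (2 * Real.pi * ((α + 1) * (2 ^ α * B))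
        + 2 * Real.pi * (K * 2 ^ α * (1 - ‖a‖ ^ 2) * (4 / 3 * (1 + 0))))) :=
    tendsto_const_nhds.add (tendsto_sourceMajorant α 0 K (by linarith))
  have hlim2 : Tendsto (fun R : ℝ => 2 * Real.pi * ((1 - (1 - R ^ 2) ^ (α + 1))
      * ((1 - ‖a‖ ^ 2) * ‖y‖))) (𝓝[<] 1)
      (𝓝 (2 * Real.pi * ((1 - (1 - 1 ^ 2) ^ (α + 1)) * ((1 - ‖a‖ ^ 2) * ‖y‖)))) := by
    -- The base vanishes at `R = 1`; continuity there comes from the exponent being nonnegative.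
    have : ContinuousAt (fun R : ℝ => (1 - R ^ 2) ^ (α + 1)) 1 :=
      ContinuousAt.rpow_const (by fun_prop) (Or.inr (by linarith))
    have h2 : ContinuousAt (fun R : ℝ => 2 * Real.pi * ((1 - (1 - R ^ 2) ^ (α + 1))
      * ((1 - ‖a‖ ^ 2) * ‖y‖))) 1 := by fun_prop
    exact h2.tendsto.mono_left nhdsWithin_le_nhds
  have hle := le_of_tendsto_of_tendsto hlim2 hlim (by
    filter_upwards [eventually_lt_norm_mobius ha hr, Ioo_mem_nhdsLT (show (0 : ℝ) < 1 by norm_num)]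
      with R hR hR1
    have hRd : (R : ℂ) ∈ disc := ofReal_mem_disc (by linarith [hR1.1]) hR1.2
    have key := h.norm_radialDzbar_sub_le hα ha hg hR1.1 hR1.2
    have hrad : ‖radialDzbar α R (fun z => mobiusDen a z ^ (α : ℂ) * f (mobius a z))
        (fun z => F (mobius a z) * conj (mobiusFactor α a z)) R‖
        ≤ 2 * Real.pi * ((α + 1) * (2 ^ α * B)) := by
      simp only [radialDzbar, sub_self, Complex.ofReal_zero, zero_mul, add_zero, mode, avg]
      rw [← intervalIntegral.integral_const_mul, ← intervalIntegral.integral_const_mul]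
      refine norm_integral_circle_le fun t => ?_
      have hzd := mul_cis_mem_disc hRd t
      have hn : ‖(R : ℂ) * cis t‖ = R := by
        rw [norm_mul, norm_cis, mul_one, Complex.norm_real, Real.norm_of_nonneg hR1.1.le]
      have h1 := norm_weighted_comp_le hα ha hzd (hB _ (mobius_mem_disc ha hzd) (hR _ hn))
      have h2 : ‖((α : ℂ) + 1)‖ = α + 1 := by
        rw [← Complex.ofReal_one, ← Complex.ofReal_add, Complex.norm_real,
          Real.norm_of_nonneg (by linarith)]
      rw [norm_mul, h2, norm_mul, norm_mul (_ ^ _), norm_zpow, norm_cis, one_zpow, one_mul,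
        Complex.norm_real, Real.norm_of_nonneg hR1.1.le]
      have h3 := mul_le_of_le_one_left ((norm_nonneg _).trans h1) hR1.2.le
      have h4 := mul_le_mul_of_nonneg_left h1 hR1.1.le
      exact mul_le_mul_of_nonneg_left (h4.trans h3) (by linarith)
    have hpow : (1 - R ^ 2) ^ (α + 1) ≤ 1 := Real.rpow_le_one (one_sub_sq_pos hR1.1 hR1.2).le
      (by nlinarith [hR1.1]) (by linarith)
    set w : ℂ := 2 * Real.pi * ((1 - (1 - R ^ 2) ^ (α + 1) : ℝ) * ((1 - ‖a‖ ^ 2 : ℝ) * y)) with hw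
    have hnorm : ‖w‖ = 2 * Real.pi * ((1 - (1 - R ^ 2) ^ (α + 1)) * ((1 - ‖a‖ ^ 2) * ‖y‖)) := by
      rw [hw, norm_mul, norm_mul, norm_mul, norm_mul, Complex.norm_real, Complex.norm_real,
        Complex.norm_real, Real.norm_of_nonneg hπ.le, Real.norm_of_nonneg ha1.le,
        Real.norm_of_nonneg (by linarith)]
      simp
    rw [← hnorm]
    have := norm_le_norm_add_norm_sub' w
      (radialDzbar α R (fun z => mobiusDen a z ^ (α : ℂ) * f (mobius a z))
        (fun z => F (mobius a z) * conj (mobiusFactor α a z)) R)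
    rw [norm_sub_rev] at this
    linarith)
  have h2π : 0 < 2 * Real.pi := by positivity
  rw [← mul_add] at hle
  have := le_of_mul_le_mul_left hle h2π
  rw [one_pow, sub_self, Real.zero_rpow (by linarith)] at this
  linarith

end WeightedSystem

/-! ### From classical solutions to first-order systems, and their rotational averages -/

theorem contDiffOn_fderiv_apply {n : WithTop ℕ∞} {u : ℂ → ℂ} (hu : ContDiffOn ℝ (n + 1) u disc)
    (h : ℂ) : ContDiffOn ℝ n (fun z => fderiv ℝ u z h) disc :=
  (hu.fderiv_of_isOpen isOpen_disc le_rfl).clm_apply contDiffOn_const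

theorem contDiffOn_dz {n : WithTop ℕ∞} {u : ℂ → ℂ} (hu : ContDiffOn ℝ (n + 1) u disc) :
    ContDiffOn ℝ n (dz u) disc :=
  contDiffOn_const.mul ((contDiffOn_fderiv_apply hu 1).sub
    (contDiffOn_const.mul (contDiffOn_fderiv_apply hu Complex.I)))

theorem contDiffOn_dzbar {n : WithTop ℕ∞} {u : ℂ → ℂ} (hu : ContDiffOn ℝ (n + 1) u disc) :
    ContDiffOn ℝ n (dzbar u) disc :=
  contDiffOn_const.mul ((contDiffOn_fderiv_apply hu 1).add
    (contDiffOn_const.mul (contDiffOn_fderiv_apply hu Complex.I)))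

theorem contDiffOn_weight {n : WithTop ℕ∞} (β : ℝ) :
    ContDiffOn ℝ n (fun z : ℂ => (((1 - ‖z‖ ^ 2 : ℝ) ^ β : ℝ) : ℂ)) disc := by
  refine Complex.ofRealCLM.contDiff.comp_contDiffOn ?_
  refine ContDiffOn.rpow_const_of_ne ?_ fun z hz => (one_sub_normSq_pos hz).ne'
  exact contDiffOn_const.sub (contDiff_norm_sq ℝ).contDiffOn

/-- A classical solution of the weighted equation gives a first-order system. -/
theorem weightedSystem_of_contDiffOn {α : ℝ} {f g : ℂ → ℂ} (hf : ContDiffOn ℝ 2 f disc)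
    (heq : ∀ z ∈ disc, weightedLaplacian α f z = g z) :
    WeightedSystem α f (dz f) (fun z => (((1 - ‖z‖ ^ 2 : ℝ) ^ (-α) : ℝ) : ℂ) * dzbar f z) g
      (dzbar fun z => (((1 - ‖z‖ ^ 2 : ℝ) ^ (-α) : ℝ) : ℂ) * dzbar f z) := by
  have hf' : ContDiffOn ℝ (1 + 1) f disc := by rwa [one_add_one_eq_two]
  have hF : ContDiffOn ℝ 1 (fun z => (((1 - ‖z‖ ^ 2 : ℝ) ^ (-α) : ℝ) : ℂ) * dzbar f z) disc :=
    (contDiffOn_weight (-α)).mul (contDiffOn_dzbar hf')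
  have hF' : ContDiffOn ℝ (0 + 1)
      (fun z => (((1 - ‖z‖ ^ 2 : ℝ) ^ (-α) : ℝ) : ℂ) * dzbar f z) disc := by rwa [zero_add]
  refine ⟨fun z hz => ?_, fun z hz => ?_, (contDiffOn_dz hf').continuousOn,
    (contDiffOn_dz hF').continuousOn.congr fun z hz => (heq z hz).symm,
    (contDiffOn_dzbar hF').continuousOn⟩
  · refine ((hf.differentiableOn two_ne_zero).differentiableAt
      (isOpen_disc.mem_nhds hz)).hasWirtingerDerivAt.congr_deriv rfl ?_
    rw [← mul_assoc, ← Complex.ofReal_mul, ← Real.rpow_add (one_sub_normSq_pos hz)]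
    simp
  · exact ((hF.differentiableOn one_ne_zero).differentiableAt
      (isOpen_disc.mem_nhds hz)).hasWirtingerDerivAt.congr_deriv (heq z hz) rfl

theorem avg_weight (κ : ℝ → ℂ) (α : ℝ) (F : ℂ → ℂ) (z : ℂ) :
    avg κ (fun z => (((1 - ‖z‖ ^ 2 : ℝ) ^ α : ℝ) : ℂ) * F z) z
      = ((1 - ‖z‖ ^ 2 : ℝ) ^ α : ℝ) * avg κ F z := by
  simp only [avg]
  rw [← intervalIntegral.integral_const_mul]
  congr 1
  ext t
  rw [norm_mul, norm_cis, mul_one]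
  ring

/-- Rotational averages of solutions are solutions. -/
theorem WeightedSystem.avg {α : ℝ} {f p F g q : ℂ → ℂ} (h : WeightedSystem α f p F g q)
    {κ : ℝ → ℂ} (hκ : Continuous κ) :
    WeightedSystem α (avg κ f) (avg (fun t => κ t * cis t) p) (avg (fun t => κ t * cis (-t)) F)
      (avg κ g) (avg (fun t => κ t * cis (-t) * cis (-t)) q) where
  deriv_left z hz := by
    refine (hasWirtingerDerivAt_avg hκ h.continuousOn_p h.continuousOn_dzbar h.deriv_left
      hz).congr_deriv rfl ?_
    rw [avg_weight]
  deriv_right z hz := by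
    have hκ' : Continuous fun t => κ t * cis (-t) := by fun_prop
    refine (hasWirtingerDerivAt_avg hκ' h.continuousOn_g h.continuousOn_q h.deriv_right
      hz).congr_deriv ?_ rfl
    simp [mul_assoc]
  continuousOn_p := continuousOn_avg (by fun_prop) h.continuousOn_p
  continuousOn_g := continuousOn_avg hκ h.continuousOn_g
  continuousOn_q := continuousOn_avg (by fun_prop) h.continuousOn_q

/-! ### Trigonometric approximate identities -/

section Kernel

/-- The function `(1 - cos t) / 2 = sin² (t/2)`, peaking at `t = π`. -/
def peak (t : ℝ) : ℝ := (1 - Real.cos t) / 2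

@[fun_prop]
theorem continuous_peak : Continuous peak := by
  unfold peak
  fun_prop

theorem peak_nonneg (t : ℝ) : 0 ≤ peak t := by
  have := Real.cos_le_one t
  unfold peak
  linarith

theorem integral_peak_pow_pos (n : ℕ) : 0 < ∫ t in (0 : ℝ)..(2 * Real.pi), peak t ^ n := by
  have hπ := Real.pi_pos
  refine intervalIntegral.integral_pos (by positivity) (by fun_prop)
    (fun t _ => pow_nonneg (peak_nonneg t) n) ⟨Real.pi, ⟨hπ.le, by linarith⟩, ?_⟩
  simp [peak]

/-- The powers of `peak`, normalised to have integral `1`. -/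
def peakKernel (n : ℕ) (t : ℝ) : ℝ :=
  (∫ t in (0 : ℝ)..(2 * Real.pi), peak t ^ n)⁻¹ * peak t ^ n

@[fun_prop]
theorem continuous_peakKernel (n : ℕ) : Continuous (peakKernel n) := by
  unfold peakKernel
  fun_prop

theorem peakKernel_nonneg (n : ℕ) (t : ℝ) : 0 ≤ peakKernel n t :=
  mul_nonneg (inv_nonneg.2 (integral_peak_pow_pos n).le) (pow_nonneg (peak_nonneg t) n)

theorem integral_peakKernel (n : ℕ) : ∫ t in (0 : ℝ)..(2 * Real.pi), peakKernel n t = 1 := by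
  simp only [peakKernel]
  rw [intervalIntegral.integral_const_mul, inv_mul_cancel₀ (integral_peak_pow_pos n).ne']

theorem norm_avg_peakKernel_le (n : ℕ) {u : ℂ → ℂ} {z : ℂ} {M : ℝ}
    (hM : ∀ t, ‖u (z * cis t)‖ ≤ M) : ‖avg (fun t => (peakKernel n t : ℂ)) u z‖ ≤ M := by
  have h := intervalIntegral.norm_integral_le_of_norm_le (μ := MeasureTheory.volume)
    (f := fun t => (peakKernel n t : ℂ) * u (z * cis t)) (g := fun t => peakKernel n t * M)
    (by positivity : (0 : ℝ) ≤ 2 * Real.pi) (Eventually.of_forall fun t _ => by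
      rw [norm_mul, Complex.norm_real, Real.norm_of_nonneg (peakKernel_nonneg n t)]
      exact mul_le_mul_of_nonneg_left (hM t) (peakKernel_nonneg n t))
    ((by fun_prop : Continuous fun t => peakKernel n t * M).intervalIntegrable _ _)
  rwa [intervalIntegral.integral_mul_const, integral_peakKernel, one_mul] at h

/-- Normalised powers of a function with a unique maximum concentrate there. The peak is placed at
`π` so that it is interior to the interval of integration. -/
theorem tendsto_integral_peakKernel {w : ℝ → ℂ} (hw : Continuous w) :
    Tendsto (fun n => ∫ t in (0 : ℝ)..(2 * Real.pi), (peakKernel n t : ℂ) * w t) atTop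
      (𝓝 (w Real.pi)) := by
  have hπ := Real.pi_pos
  have h := tendsto_setIntegral_pow_smul_of_unique_maximum_of_isCompact_of_continuousOn
    (μ := MeasureTheory.volume) (s := Icc 0 (2 * Real.pi)) (c := peak) (x₀ := Real.pi) (g := w)
    isCompact_Icc continuous_peak.continuousOn (fun y hy hne => ?_) (fun t _ => peak_nonneg t)
    (by simp [peak]) ?_ hw.continuousOn
  · refine h.congr fun n => ?_
    rw [MeasureTheory.integral_Icc_eq_integral_Ioc, MeasureTheory.integral_Icc_eq_integral_Ioc,
      ← intervalIntegral.integral_of_le (by positivity),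
      ← intervalIntegral.integral_of_le (by positivity), ← intervalIntegral.integral_smul]
    congr 1
    ext t
    simp [peakKernel, mul_assoc]
  · have h1 : -1 < Real.cos y := by
      refine lt_of_le_of_ne (Real.neg_one_le_cos y) fun hc => hne ?_
      have h2 : Real.cos (y - Real.pi) = 1 := by rw [Real.cos_sub_pi, ← hc, neg_neg]
      have h3 := (Real.cos_eq_one_iff_of_lt_of_lt (by linarith [hy.1]) (by linarith [hy.2])).1 h2
      linarith
    simp [peak]
    linarith
  · rw [interior_Icc]
    exact subset_closure ⟨hπ, by linarith⟩

/-- Being a trigonometric polynomial is what reduces an average against the kernel to finitely many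
modes. -/
theorem exists_peakKernel_eq_sum (n : ℕ) :
    ∃ (m : ℕ) (b : ℕ → ℂ) (k : ℕ → ℤ), ∀ t,
      (peakKernel n t : ℂ) = ∑ j ∈ Finset.range m, b j * cis t ^ k j := by
  have hpk : ∀ t, (peak t : ℂ) = (-1 / 4) * ((cis t + -1) ^ 2 * (cis t)⁻¹) := fun t => by
    have h0 := cis_ne_zero t
    have h1 : (cis t)⁻¹ = cis (-t) := by rw [Complex.inv_eq_conj (norm_cis t), conj_cis]
    have h2 : cis t + cis (-t) = 2 * Complex.cos t := by
      rw [Complex.cos, cis, cis]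
      push_cast
      ring
    have h3 : (cis t + -1) ^ 2 * (cis t)⁻¹ = cis t + (cis t)⁻¹ - 2 := by
      field_simp
      ring
    rw [h3, h1, h2, peak]
    push_cast
    ring
  set Z : ℝ := ∫ t in (0 : ℝ)..(2 * Real.pi), peak t ^ n with hZ
  -- The binomial expansion of `(e^{it} - 1)^(2n) e^{-int}`, with frequencies from `-n` to `n`.
  refine ⟨2 * n + 1, fun j => (Z : ℂ)⁻¹ * (-1 / 4) ^ n * ((-1) ^ (2 * n - j) * (2 * n).choose j),
    fun j => j - n, fun t => ?_⟩
  have h0 := cis_ne_zero t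
  rw [peakKernel, ← hZ, Complex.ofReal_mul, Complex.ofReal_pow, hpk, mul_pow, mul_pow, ← pow_mul,
    add_pow, Finset.sum_mul, Finset.mul_sum, Complex.ofReal_inv, Finset.mul_sum]
  refine Finset.sum_congr rfl fun j _ => ?_
  rw [zpow_sub₀ h0, zpow_natCast, zpow_natCast, div_eq_mul_inv, inv_pow]
  ring

end Kernel

theorem avg_sum_zpow {u : ℂ → ℂ} {z : ℂ} (hu : Continuous fun t => u (z * cis t)) (m : ℕ)
    (b : ℕ → ℂ) (k : ℕ → ℤ) :
    avg (fun t => ∑ j ∈ Finset.range m, b j * cis t ^ k j) u z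
      = ∑ j ∈ Finset.range m, b j * mode (-k j) u z := by
  simp only [avg, mode, neg_neg, Finset.sum_mul, mul_assoc]
  rw [intervalIntegral.integral_finsetSum (f := fun j t => b j * (cis t ^ k j * u (z * cis t)))
    fun j _ => ((((continuous_cis_zpow (k j)).mul hu).const_mul (b j)).intervalIntegrable _ _)]
  simp only [intervalIntegral.integral_const_mul]

/-! ### Boundary behaviour of the averages -/

theorem tendsto_mode_boundary {f fstar : ℂ → ℂ} (h : HasDistributionalBoundaryValue f fstar)
    (k : ℤ) : Tendsto (fun r : ℝ => mode k f r) (𝓝[<] 1) (𝓝 (mode k fstar 1)) := by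
  have hφ : ContDiff ℝ ∞ fun t => cis (((-k : ℤ) : ℝ) * t) :=
    contDiff_cis.comp (contDiff_const.mul contDiff_id)
  have hper : Function.Periodic (fun t => cis (((-k : ℤ) : ℝ) * t)) (2 * Real.pi) := fun t => by
    simp only [cis_int_mul, periodic_cis t]
  have := h _ hφ hper
  simp only [cis_int_mul] at this
  simpa [mode, avg, cis, mul_comm] using this

/-- Averages against the peak kernels attain their boundary values uniformly. -/
theorem norm_avg_peakKernel_le_near_boundary {f fstar : ℂ → ℂ} (hf : ContinuousOn f disc)
    (hfstar : ContinuousOn fstar unitCircle) (h : HasDistributionalBoundaryValue f fstar) {M B : ℝ}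
    (hM : ∀ z ∈ unitCircle, ‖fstar z‖ ≤ M) (hB : M < B) (n : ℕ) :
    ∃ r < 1, ∀ z ∈ disc, r < ‖z‖ → ‖avg (fun t => (peakKernel n t : ℂ)) f z‖ ≤ B := by
  obtain ⟨m, b, k, hκ⟩ := exists_peakKernel_eq_sum n
  have hlim : Tendsto (fun r : ℝ => ∑ j ∈ Finset.range m,
      ‖b j‖ * ‖mode (-k j) f r - mode (-k j) fstar 1‖) (𝓝[<] 1) (𝓝 0) := by
    have : Tendsto (fun r : ℝ => ∑ j ∈ Finset.range m,
      ‖b j‖ * ‖mode (-k j) f r - mode (-k j) fstar 1‖) (𝓝[<] 1)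
      (𝓝 (∑ j ∈ Finset.range m, ‖b j‖ * ‖mode (-k j) fstar 1 - mode (-k j) fstar 1‖)) :=
      tendsto_finsetSum _ fun j _ =>
        (((tendsto_mode_boundary h (-k j)).sub_const _).norm).const_mul _
    simpa using this
  have hev := hlim.eventually_le_const (sub_pos.2 hB)
  obtain ⟨r, hr, hrs⟩ := mem_nhdsLT_iff_exists_Ioo_subset.1 hev
  refine ⟨r, hr, fun z hz hrz => ?_⟩
  have hz1 := mem_disc.1 hz
  have hpolar : z = ‖z‖ * cis z.arg := (Complex.norm_mul_exp_arg_mul_I z).symm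
  have hcirc : ∀ t, cis z.arg * cis t ∈ unitCircle := fun t => by simp [unitCircle]
  have c1 : Continuous fun t => f (z * cis t) :=
    hf.comp_continuous (by fun_prop) fun t => mul_cis_mem_disc hz t
  have c2 : Continuous fun t => fstar (cis z.arg * cis t) :=
    hfstar.comp_continuous (by fun_prop) hcirc
  have e1 := norm_avg_peakKernel_le n (u := fstar) (z := cis z.arg) fun t => hM _ (hcirc t)
  have hmem : (∑ j ∈ Finset.range m,
      ‖b j‖ * ‖mode (-k j) f (‖z‖ : ℝ) - mode (-k j) fstar 1‖) ≤ B - M := hrs ⟨hrz, hz1⟩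
  have e2 : ‖avg (fun t => (peakKernel n t : ℂ)) f z
      - avg (fun t => (peakKernel n t : ℂ)) fstar (cis z.arg)‖ ≤ B - M := by
    simp only [hκ]
    rw [avg_sum_zpow c1, avg_sum_zpow c2, ← Finset.sum_sub_distrib]
    refine (norm_sum_le _ _).trans (le_trans (Finset.sum_le_sum fun j _ => ?_) hmem)
    -- Rotation covariance gives both modes the same unimodular phase, so convergence along the
    -- radius is uniform in the angle.
    have m1 : mode (-k j) f z = cis ((-k j : ℤ) * z.arg) * mode (-k j) f (‖z‖ : ℝ) := by
      conv_lhs => rw [hpolar]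
      rw [mode_mul_cis]
    have m2 : mode (-k j) fstar (cis z.arg) = cis ((-k j : ℤ) * z.arg) * mode (-k j) fstar 1 := by
      rw [← mode_mul_cis, one_mul]
    rw [m1, m2, ← mul_sub, ← mul_sub, norm_mul, norm_mul, norm_cis, one_mul]
  have := norm_le_norm_add_norm_sub' (avg (fun t => (peakKernel n t : ℂ)) f z)
    (avg (fun t => (peakKernel n t : ℂ)) fstar (cis z.arg))
  linarith

/-! ### Assembling the gradient estimate -/

theorem norm_fderiv_le_of_wirtinger {α M K : ℝ} {f : ℂ → ℂ} {a : ℂ} (hα : 0 ≤ α) (hK : 0 ≤ K)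
    (ha : a ∈ disc)
    (h1 : (1 - ‖a‖ ^ 2) * ‖dz f a‖
      ≤ (α + 1) * 2 ^ α * M + K * 2 ^ α * (1 - ‖a‖ ^ 2) * (4 / 3 * (1 + α)))
    (h2 : (1 - ‖a‖ ^ 2) * ‖dzbar f a‖
      ≤ (α + 1) * 2 ^ α * M + K * 2 ^ α * (1 - ‖a‖ ^ 2) * (4 / 3)) :
    ‖fderiv ℝ f a‖ ≤ (α + 1) * (2 : ℝ) ^ (α + 1) * M * (1 / (1 - ‖a‖ ^ 2))
      + (α + 4 / 3) * (2 : ℝ) ^ (α + 1) * K := by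
  have ha1 := one_sub_normSq_pos ha
  refine (norm_fderiv_le f a).trans ?_
  rw [Real.rpow_add_one two_ne_zero]
  have h2α : (0 : ℝ) < 2 ^ α := Real.rpow_pos_of_pos two_pos α
  generalize (2 : ℝ) ^ α = y at *
  generalize 1 - ‖a‖ ^ 2 = x at *
  -- The two source constants add up to `8/3 + 4α/3`, which is at most `2 (α + 4/3)`; the slack is a
  -- multiple of this product.
  have h3 : 0 ≤ α * y * K * x := by positivity
  refine le_of_mul_le_mul_left ?_ ha1
  have h4 : x * ((α + 1) * (y * 2) * M * (1 / x) + (α + 4 / 3) * (y * 2) * K)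
      = (α + 1) * (y * 2) * M + (α + 4 / 3) * (y * 2) * K * x := by
    field_simp
  rw [h4]
  linarith

theorem norm_le_supNorm {S T : Set ℂ} {u : ℂ → ℂ} (hST : S ⊆ T) (hT : IsCompact T)
    (hu : ContinuousOn u T) {z : ℂ} (hz : z ∈ S) : ‖u z‖ ≤ supNorm S u := by
  have hbdd : BddAbove ((fun z => ‖u z‖) '' S) :=
    (hT.bddAbove_image hu.norm).mono (image_mono hST)
  exact le_csSup hbdd (mem_image_of_mem _ hz)

/-- The gradient estimate for solutions of the Dirichlet problem with distributional boundary
values. -/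
theorem WeightedSystem.norm_fderiv_le {α M K : ℝ} {f p F g q fstar : ℂ → ℂ}
    (h : WeightedSystem α f p F g q) (hα : 0 ≤ α) (hfstar : ContinuousOn fstar unitCircle)
    (hbd : HasDistributionalBoundaryValue f fstar) (hM : ∀ z ∈ unitCircle, ‖fstar z‖ ≤ M)
    (hK : ∀ z ∈ disc, ‖g z‖ ≤ K) {a : ℂ} (ha : a ∈ disc) :
    ‖fderiv ℝ f a‖ ≤ (α + 1) * (2 : ℝ) ^ (α + 1) * M * (1 / (1 - ‖a‖ ^ 2))
      + (α + 4 / 3) * (2 : ℝ) ^ (α + 1) * K := by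
  -- The kernels concentrate at the angle `π`, where `e^{iπ} = -1`, so the averages are estimated at
  -- `-a` to reach `a` in the limit.
  have hna : -a ∈ disc := by simpa [mem_disc] using ha
  have hπ : cis Real.pi = -1 := by rw [cis, Complex.exp_pi_mul_I]
  have hsys : ∀ n, WeightedSystem α (AlphaHarmonic.avg (fun t => (peakKernel n t : ℂ)) f) _ _ _ _ :=
    fun n => h.avg (by fun_prop)
  have hgn : ∀ n, ∀ z ∈ disc, ‖AlphaHarmonic.avg (fun t => (peakKernel n t : ℂ)) g z‖ ≤ K :=
    fun n z hz => norm_avg_peakKernel_le n fun t => hK _ (mul_cis_mem_disc hz t)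
  -- For each fixed kernel the boundary bound `B` may be any number above `M`; letting `B` decrease
  -- to `M` precedes the limit in `n`.
  have hlimB : ∀ C D : ℝ, Tendsto (fun B => C * B + D) (𝓝[>] M) (𝓝 (C * M + D)) := fun C D =>
    ((by fun_prop : Continuous fun B => C * B + D).tendsto M).mono_left nhdsWithin_le_nhds
  have hdz : ∀ n, (1 - ‖a‖ ^ 2) * ‖∫ t in (0 : ℝ)..(2 * Real.pi),
      (peakKernel n t : ℂ) * (cis t * p (-a * cis t))‖
      ≤ (α + 1) * 2 ^ α * M + K * 2 ^ α * (1 - ‖a‖ ^ 2) * (4 / 3 * (1 + α)) := fun n => by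
    refine ge_of_tendsto (hlimB _ _) (eventually_nhdsWithin_of_forall fun B hB => ?_)
    obtain ⟨r, hr, hrB⟩ := norm_avg_peakKernel_le_near_boundary h.continuousOn_f hfstar hbd hM hB n
    have := (hsys n).norm_dz_le_of_boundary hα hna (hgn n) hr hrB
    simpa only [AlphaHarmonic.avg, norm_neg, mul_assoc] using this
  have hdzbar : ∀ n, (1 - ‖a‖ ^ 2) * ‖∫ t in (0 : ℝ)..(2 * Real.pi),
      (peakKernel n t : ℂ) * (cis (-t) * ((((1 - ‖-a * cis t‖ ^ 2 : ℝ) ^ α : ℝ) : ℂ)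
        * F (-a * cis t)))‖
      ≤ (α + 1) * 2 ^ α * M + K * 2 ^ α * (1 - ‖a‖ ^ 2) * (4 / 3) := fun n => by
    refine ge_of_tendsto (hlimB _ _) (eventually_nhdsWithin_of_forall fun B hB => ?_)
    obtain ⟨r, hr, hrB⟩ := norm_avg_peakKernel_le_near_boundary h.continuousOn_f hfstar hbd hM hB n
    have := (hsys n).norm_dzbar_le_of_boundary hα hna (hgn n) hr hrB
    rw [(hasWirtingerDerivAt_avg (by fun_prop) h.continuousOn_p h.continuousOn_dzbar h.deriv_left
      hna).dzbar_eq] at this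
    simpa only [AlphaHarmonic.avg, norm_neg, mul_assoc] using this
  have c1 : Continuous fun t => cis t * p (-a * cis t) :=
    continuous_mul_comp_cis continuous_cis h.continuousOn_p hna
  have c2 : Continuous fun t => cis (-t) * ((((1 - ‖-a * cis t‖ ^ 2 : ℝ) ^ α : ℝ) : ℂ)
        * F (-a * cis t)) :=
    continuous_mul_comp_cis (by fun_prop) h.continuousOn_dzbar hna
  have l1 := le_of_tendsto' ((tendsto_integral_peakKernel c1).norm.const_mul (1 - ‖a‖ ^ 2)) hdz
  have l2 := le_of_tendsto' ((tendsto_integral_peakKernel c2).norm.const_mul (1 - ‖a‖ ^ 2)) hdzbar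
  have hd := h.deriv_left a ha
  refine norm_fderiv_le_of_wirtinger hα ((norm_nonneg _).trans (hK a ha)) ha ?_ ?_
  · rw [hd.dz_eq]
    simpa [hπ] using l1
  · rw [hd.dzbar_eq]
    have e : (-a) * cis Real.pi = a := by rw [hπ]; ring
    rwa [e, norm_mul (cis _), norm_cis, one_mul] at l2

/-- The gradient estimate for bounded solutions of the homogeneous equation. -/
theorem WeightedSystem.norm_fderiv_le_of_mapsTo {α : ℝ} {f p F g q : ℂ → ℂ}
    (h : WeightedSystem α f p F g q) (hα : 0 ≤ α) (hg : ∀ z ∈ disc, g z = 0)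
    (hmaps : MapsTo f disc disc) {a : ℂ} (ha : a ∈ disc) :
    ‖fderiv ℝ f a‖ ≤ (α + 1) * (2 : ℝ) ^ (α + 1) * (1 / (1 - ‖a‖ ^ 2)) := by
  have hg0 : ∀ z ∈ disc, ‖g z‖ ≤ 0 := fun z hz => by simp [hg z hz]
  -- Here `f` itself is bounded by `1`, so neither boundary values nor averaging are needed.
  have hB : ∀ z ∈ disc, 0 < ‖z‖ → ‖f z‖ ≤ 1 := fun z hz _ => (mem_disc.1 (hmaps hz)).le
  have h1 := h.norm_dz_le_of_boundary hα ha hg0 one_pos hB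
  rw [← (h.deriv_left a ha).dz_eq] at h1
  have := norm_fderiv_le_of_wirtinger hα le_rfl ha h1
    (h.norm_dzbar_le_of_boundary hα ha hg0 one_pos hB)
  simpa using this

end

end AlphaHarmonic

theorem theorem2p2 (α : ℝ) (hα : 0 ≤ α) (g fstar f : ℂ → ℂ)
    (hg : ContinuousOn g AlphaHarmonic.closedDisc)
    (hfstar : ContinuousOn fstar AlphaHarmonic.unitCircle)
    (hf : ContDiffOn ℝ 2 f AlphaHarmonic.disc)
    (hsol : AlphaHarmonic.SolvesDirichlet α g fstar f) :
    (∀ z ∈ AlphaHarmonic.disc,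
      ‖fderiv ℝ f z‖ ≤
        (α + 1) * (2 : ℝ) ^ (α + 1) * AlphaHarmonic.supNorm AlphaHarmonic.unitCircle fstar
            * (1 / (1 - ‖z‖ ^ 2))
          + (α + 4 / 3) * (2 : ℝ) ^ (α + 1) * AlphaHarmonic.supNorm AlphaHarmonic.disc g) ∧
    ((∀ z ∈ AlphaHarmonic.closedDisc, g z = 0) →
      Set.MapsTo f AlphaHarmonic.disc AlphaHarmonic.disc →
      ∀ z ∈ AlphaHarmonic.disc,
        ‖fderiv ℝ f z‖ ≤ (α + 1) * (2 : ℝ) ^ (α + 1) * (1 / (1 - ‖z‖ ^ 2))) := by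
  have hdisc : AlphaHarmonic.disc ⊆ AlphaHarmonic.closedDisc := Metric.ball_subset_closedBall
  have h := AlphaHarmonic.weightedSystem_of_contDiffOn hf hsol.equation
  refine ⟨fun z hz => ?_, fun hg0 hmaps z hz => ?_⟩
  · exact h.norm_fderiv_le hα hfstar hsol.boundary
      (fun w hw => AlphaHarmonic.norm_le_supNorm subset_rfl (isCompact_sphere 0 1) hfstar hw)
      (fun w hw => AlphaHarmonic.norm_le_supNorm hdisc (isCompact_closedBall 0 1) hg hw) hz
  · exact h.norm_fderiv_le_of_mapsTo hα (fun w hw => hg0 w (hdisc hw)) hmaps hz
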